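/- Let $k$ be an algebraically closed field of characteristic $p>0$, let $X$ be a smooth projective (equivalently, smooth proper) integral surface over $k$, and let $f\colon X\to\mathbb P^1_k$ be a conic bundle, i.e. a $k$-morphism such that for every point $y\in\mathbb P^1_k$ (closed or generic) the scheme-theoretic fibre $X_y$ is reduced and isomorphic over the residue field $\kappa(y)$ to a plane conic $V_+(q)\subset\mathbb P^2_{\kappa(y)}$ for some nonzero quadratic form $q$. Let $\sigma$ be an automorphism of $X$ over $k$ which preserves the conic bundle, i.e. $f\circ\sigma=\tau\circ f$ for some automorphism $\tau$ of $\mathbb P^1_k$ over $k$. If the order of $\sigma$ is $p^s$ with $s\ge 0$, then $s\le 2$. -/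

import Mathlib

open AlgebraicGeometry CategoryTheory

universe u

namespace ConicBundle

noncomputable section

/-- The homogeneous coordinate ring `K[x₀, …, xₙ]`, graded by degree. -/
abbrev grading (K : Type u) [Field K] (n : ℕ) : ℕ → Submodule K (MvPolynomial (Fin (n + 1)) K) :=
  MvPolynomial.homogeneousSubmodule (Fin (n + 1)) K

instance gradedRing (K : Type u) [Field K] (n : ℕ) : GradedRing (grading K n) :=
  MvPolynomial.gradedAlgebra

/-- Projective space `ℙⁿ` over a field `K`, as a scheme over `Spec K`. -/
def projectiveSpace (K : Type u) [Field K] (n : ℕ) : Over (Spec (.of K)) :=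
  Over.mk (Proj.toSpecZero (grading K n) ≫
    Spec.map (CommRingCat.ofHom (algebraMap K (grading K n 0))))

/-- The standard affine chart `D₊(xⱼ)` of `ℙⁿ`. -/
def chart (K : Type u) [Field K] (n : ℕ) (j : Fin (n + 1)) :
    (projectiveSpace K n).left.affineOpens :=
  ⟨Proj.basicOpen (grading K n) (MvPolynomial.X j),
    Proj.isAffineOpen_basicOpen (grading K n) (MvPolynomial.X j)
      (MvPolynomial.isHomogeneous_X K j) Nat.one_pos⟩

/-- The regular function `q / xⱼᵈ` on the chart `D₊(xⱼ)`, for `q` homogeneous of degree `d`. -/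
def dehomogenize {K : Type u} [Field K] {n d : ℕ} {q : MvPolynomial (Fin (n + 1)) K}
    (hq : q.IsHomogeneous d) (j : Fin (n + 1)) :
    Γ((projectiveSpace K n).left, (chart K n j).1) :=
  Proj.awayToSection (grading K n) (MvPolynomial.X j)
    (HomogeneousLocalization.Away.mk (grading K n) (MvPolynomial.isHomogeneous_X K j) d q
      (by simpa using hq))

/-- A scheme `C` over a field `K` is a plane conic if it is isomorphic over `K` to the closed
subscheme `V₊(q)` of `ℙ²` cut out by a nonzero quadratic form `q`; that is, it has a closed
immersion into `ℙ²` over `K` whose ideal is generated by `q / xⱼ²` on each chart `D₊(xⱼ)`. -/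
def IsPlaneConic {K : Type u} [Field K] (C : Over (Spec (.of K))) : Prop :=
  ∃ (q : MvPolynomial (Fin 3) K) (hq : q.IsHomogeneous 2) (i : C ⟶ projectiveSpace K 2),
    q ≠ 0 ∧ IsClosedImmersion i.left ∧
      ∀ j : Fin 3, i.left.ker.ideal (chart K 2 j) = Ideal.span {dehomogenize hq j}

/-- The scheme-theoretic fibre of `f` over the point `y`, as a scheme over the residue field. -/
def fibre {X Y : Scheme.{u}} (f : X ⟶ Y) (y : Y) : Over (Spec (.of (Y.residueField y))) :=
  Over.mk (f.fiberToSpecResidueField y)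

/-- A smooth proper integral surface over `k`. -/
structure IsSmoothProperSurface {k : Type u} [Field k] (X : Over (Spec (.of k))) : Prop where
  isIntegral : IsIntegral X.left
  isProper : IsProper X.hom
  smooth : SmoothOfRelativeDimension 2 X.hom

/-- A conic bundle over `ℙ¹`: a morphism over `k` from a smooth proper surface to `ℙ¹`, all of
whose scheme-theoretic fibres are reduced plane conics over the residue field of the point. -/
structure IsConicBundle {k : Type u} [Field k] {X : Over (Spec (.of k))}
    (f : X ⟶ projectiveSpace k 1) : Prop where
  surface : IsSmoothProperSurface X
  isPlaneConic_fibre : ∀ y : (projectiveSpace k 1).left, IsPlaneConic (fibre f.left y)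
  isReduced_fibre : ∀ y : (projectiveSpace k 1).left, IsReduced (fibre f.left y).left

/-- An automorphism `σ` of `X` preserves `f : X ⟶ B` if it permutes the fibres of `f`, that is,
it lies over an automorphism of the base `B`. -/
def PreservesFibration {k : Type u} [Field k] {X B : Over (Spec (.of k))} (f : X ⟶ B)
    (σ : Aut X) : Prop :=
  ∃ τ : Aut B, σ.hom ≫ f = f ≫ τ.hom

end

end ConicBundle

/-! The automorphism is read off from its action on the function field `F` of the surface, which
contains the function field `K = k(t)` of the base. Both steps of the tower `k ⊂ K ⊂ F` turn out to
be simple transcendental, and each contributes at most one factor `p` to the order.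

The factor `p` is a fact about `PGL₂` over a field `L` of characteristic `p`
(`algHom_pow_char_eq_one`). Automorphisms of `L(z)` over `L` are fractional linear. If a power `M ^
p ^ m` of the matrix is scalar, then over the algebraic closure `M - α` is nilpotent for some `α`,
hence has square zero, so `M ^ p = α ^ p` is already scalar. This is applied first to the action on
`K` over `k`. The `p`-th power of the automorphism then fixes `K`, and the same fact is applied to
`F` over `K` (`ringHom_pow_char_sq_eq_one`).

That `F = K(w)` comes from the generic fibre, a conic over `K`. Tsen's theorem (`exists_isotropic`)
gives it a rational point. Smoothness of the fibre over `K` is not assumed, so nonsingularity at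
that point is deduced from smoothness of the surface over `k`: the local ring of the fibre there is
a local ring of the surface, and formal smoothness over `k` forces the equation to have a nonzero
linear part (`IsConicRing.linear_ne_zero`). Projection from the point then parametrizes the conic.
Finally, an automorphism of an integral separated scheme is determined by its action on the function
field (`pow_eq_one_iff_residueField`). -/

namespace ConicBundle

/-! ### Automorphisms of `p`-power order of simple transcendental extensions -/

section Mobius

open Polynomial

/-- An endomorphism of a simple transcendental extension `L(z)` whose image generates
is a fractional linear transformation. -/
theorem exists_fractional_linear {L F : Type*} [Field L] [Field F] [Algebra L F] {z : F}
    (hz : Transcendental L z) (hgen : IntermediateField.adjoin L {z} = ⊤) {w : F}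
    (hw : IntermediateField.adjoin L {w} = ⊤) :
    ∃ a b c d : L, algebraMap L F c * z + algebraMap L F d ≠ 0 ∧
      w * (algebraMap L F c * z + algebraMap L F d) =
        algebraMap L F a * z + algebraMap L F b := by
  have hinj : Function.Injective (aeval (R := L) z) := transcendental_iff_injective.mp hz
  let e : RatFunc L →ₐ[L] F := RatFunc.liftAlgHom (aeval z)
    (nonZeroDivisors_le_comap_nonZeroDivisors_of_injective _ hinj)
  have heX : e RatFunc.X = z := by
    rw [← RatFunc.algebraMap_X]
    simp [e, RatFunc.liftAlgHom_apply]
  have hsurj : Function.Surjective e := by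
    rw [← AlgHom.fieldRange_eq_top, ← top_le_iff, ← hgen, IntermediateField.adjoin_le_iff]
    rintro _ rfl
    exact ⟨RatFunc.X, heX⟩
  obtain ⟨f, rfl⟩ := hsurj w
  have hf : IntermediateField.adjoin L {f} = ⊤ := by
    apply IntermediateField.map_injective e
    rw [IntermediateField.adjoin_map, Set.image_singleton, hw, ← AlgHom.fieldRange_eq_map]
    exact (AlgHom.fieldRange_eq_top.mpr hsurj).symm
  -- The degree of `L(z)` over `L(f)` is the larger of the degrees of numerator and denominator.
  -- Here it is one.
  have hfin := RatFunc.finrank_eq_max_natDegree f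
  rw [hf, IntermediateField.finrank_top] at hfin
  have hn : f.num.natDegree ≤ 1 := by omega
  have hd : f.denom.natDegree ≤ 1 := by omega
  have h1 : algebraMap L[X] (RatFunc L) f.denom ≠ 0 := by
    simpa using f.denom_ne_zero
  have h2 : f * algebraMap L[X] (RatFunc L) f.denom = algebraMap L[X] (RatFunc L) f.num := by
    have h3 := f.num_div_denom
    rwa [div_eq_iff h1, eq_comm] at h3
  have h3 : ∀ q : L[X], e (algebraMap L[X] (RatFunc L) q) = aeval z q := fun q => by
    simp [e, RatFunc.liftAlgHom_apply]
  have h4 : ∀ q : L[X], q.natDegree ≤ 1 →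
      aeval z q = algebraMap L F (q.coeff 1) * z + algebraMap L F (q.coeff 0) := fun q hq => by
    conv_lhs => rw [q.eq_X_add_C_of_natDegree_le_one hq]
    simp
  refine ⟨f.num.coeff 1, f.num.coeff 0, f.denom.coeff 1, f.denom.coeff 0, ?_, ?_⟩
  · rw [← h4 _ hd, ← h3]
    simpa using h1
  · rw [← h4 _ hd, ← h3, ← h4 _ hn, ← h3, ← map_mul, h2]

/-- A `2 × 2` matrix in characteristic `p`, some `pᵐ`-th power of which is scalar, has scalar
`p`-th power. -/
theorem matrix_pow_char_scalar {L : Type*} [Field L] (p : ℕ) [Fact p.Prime] [CharP L p]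
    (M : Matrix (Fin 2) (Fin 2) L) (m : ℕ) (a : L)
    (h : M ^ p ^ m = Matrix.scalar (Fin 2) a) : ∃ b : L, M ^ p = Matrix.scalar (Fin 2) b := by
  let E := AlgebraicClosure L
  have : CharP E p := charP_of_injective_algebraMap (algebraMap L E).injective p
  have hp := (Fact.out : p.Prime)
  -- The root need not lie in `L`, which is imperfect in the application to `L = k(t)`; only `M ^ p`
  -- descends.
  obtain ⟨α, hα⟩ := IsAlgClosed.exists_pow_nat_eq (algebraMap L E a) (pow_pos hp.pos m)
  let N : Matrix (Fin 2) (Fin 2) E := M.map (algebraMap L E)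
  have hN : N ^ p ^ m = Matrix.scalar (Fin 2) (algebraMap L E a) := by
    have : N = (algebraMap L E).mapMatrix M := rfl
    rw [this, ← map_pow, h]
    ext i j
    simp [Matrix.scalar_apply, Matrix.diagonal_apply, apply_ite (algebraMap L E)]
  have hcomm : Commute N (Matrix.scalar (Fin 2) α) :=
    (Matrix.scalar_commute α (fun _ => Commute.all _ _) N).symm
  have hnil : IsNilpotent (N - Matrix.scalar (Fin 2) α) := by
    refine ⟨p ^ m, ?_⟩
    rw [sub_pow_char_pow_of_commute p m hcomm, hN, ← map_pow, hα, sub_self]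
  -- Cayley–Hamilton: a nilpotent `2 × 2` matrix has characteristic polynomial `X ^ 2`. Since `2 ≤
  -- p`, its `p`-th power vanishes too.
  have hsq : (N - Matrix.scalar (Fin 2) α) ^ 2 = 0 := by
    have h1 := (Matrix.isNilpotent_charpoly_sub_pow_of_isNilpotent hnil).eq_zero
    have h2 := Matrix.aeval_self_charpoly (N - Matrix.scalar (Fin 2) α)
    rw [sub_eq_zero.mp h1] at h2
    simpa using h2
  have hpow : N ^ p = Matrix.scalar (Fin 2) (α ^ p) := by
    have h1 : (N - Matrix.scalar (Fin 2) α) ^ p = 0 := pow_eq_zero_of_le hp.two_le hsq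
    rw [sub_pow_char_of_commute p hcomm, ← map_pow] at h1
    exact sub_eq_zero.mp h1
  have hent : ∀ i j, algebraMap L E ((M ^ p) i j) = if i = j then α ^ p else 0 := fun i j => by
    have h1 : N ^ p = (algebraMap L E).mapMatrix (M ^ p) := by rw [map_pow]; rfl
    have h2 := congrFun (congrFun (h1.symm.trans hpow) i) j
    simpa [Matrix.scalar_apply, Matrix.diagonal_apply] using h2
  refine ⟨(M ^ p) 0 0, ?_⟩
  have hi := (algebraMap L E).injective
  have h01 : (M ^ p) 0 1 = 0 := hi (by rw [hent]; simp)
  have h10 : (M ^ p) 1 0 = 0 := hi (by rw [hent]; simp)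
  have h11 : (M ^ p) 1 1 = (M ^ p) 0 0 := hi (by rw [hent, hent]; simp)
  ext i j
  fin_cases i <;> fin_cases j <;> simp [h01, h10, h11]

/-- In characteristic `p`, an automorphism of `p`-power order of a simple transcendental extension
has order dividing `p`. -/
theorem algHom_pow_char_eq_one {L F : Type*} [Field L] [Field F] [Algebra L F] (p : ℕ)
    [Fact p.Prime] [CharP L p] {z : F} (hz : Transcendental L z)
    (hgen : IntermediateField.adjoin L {z} = ⊤) (g : F →ₐ[L] F) (m : ℕ)
    (hg : g ^ p ^ m = 1) : g ^ p = 1 := by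
  have hp := (Fact.out : p.Prime)
  have hsurj : Function.Surjective g := by
    intro y
    refine ⟨(g ^ (p ^ m - 1)) y, ?_⟩
    rw [← AlgHom.mul_apply, ← pow_succ', Nat.sub_add_cancel (pow_pos hp.pos m), hg]
    rfl
  have hgz : IntermediateField.adjoin L {g z} = ⊤ := by
    rw [← Set.image_singleton, ← IntermediateField.adjoin_map, hgen, ← AlgHom.fieldRange_eq_map]
    exact AlgHom.fieldRange_eq_top.mpr hsurj
  obtain ⟨a, b, c, d, hne, hfrac⟩ := exists_fractional_linear hz hgen hgz
  let M : Matrix (Fin 2) (Fin 2) L := !![a, b; c, d]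
  let top : ℕ → F := fun n => algebraMap L F ((M ^ n) 0 0) * z + algebraMap L F ((M ^ n) 0 1)
  let bot : ℕ → F := fun n => algebraMap L F ((M ^ n) 1 0) * z + algebraMap L F ((M ^ n) 1 1)
  -- The iterate `(g ^ n) z` is the fraction `top n / bot n` given by `M ^ n`. Carrying the inverse
  -- `μ` of the denominator also records that the denominator is nonzero.
  have key : ∀ n, ∃ μ : F, μ * top n = (g ^ n) z ∧ μ * bot n = 1 := by
    intro n
    induction n with
    | zero => exact ⟨1, by simp [top], by simp [bot]⟩
    | succ n ih =>
      obtain ⟨μ, h1, h2⟩ := ih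
      have hzz : g z = (algebraMap L F a * z + algebraMap L F b) *
          (algebraMap L F c * z + algebraMap L F d)⁻¹ := by
        rw [← hfrac, mul_assoc, mul_inv_cancel₀ hne, mul_one]
      refine ⟨g μ * (algebraMap L F c * z + algebraMap L F d)⁻¹, ?_, ?_⟩
      · have := congrArg g h1
        rw [pow_succ', AlgHom.mul_apply, ← this]
        simp only [top, pow_succ, M, map_mul, map_add, AlgHom.commutes, hzz, Matrix.mul_apply,
          Fin.sum_univ_two, Matrix.of_apply, Matrix.cons_val', Matrix.cons_val_zero,
          Matrix.cons_val_one, Matrix.cons_val_fin_one]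
        field_simp
        ring
      · have := congrArg g h2
        rw [map_one] at this
        rw [← this]
        simp only [bot, pow_succ, M, map_mul, map_add, AlgHom.commutes, hzz, Matrix.mul_apply,
          Fin.sum_univ_two, Matrix.of_apply, Matrix.cons_val', Matrix.cons_val_zero,
          Matrix.cons_val_one, Matrix.cons_val_fin_one]
        field_simp
        ring
  obtain ⟨μ, h1, h2⟩ := key (p ^ m)
  rw [hg, AlgHom.one_apply] at h1
  have hμ : μ ≠ 0 := left_ne_zero_of_mul_eq_one h2
  have hrel : top (p ^ m) = z * bot (p ^ m) := by
    apply mul_left_cancel₀ hμ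
    rw [h1, mul_left_comm, h2, mul_one]
  -- A fractional linear map fixing `z` gives a quadratic relation for `z` over `L`. By
  -- transcendence all its coefficients vanish.
  have hscalar : M ^ p ^ m = Matrix.scalar (Fin 2) ((M ^ p ^ m) 0 0) := by
    set A := M ^ p ^ m with hA
    have hpoly : (C (A 1 0) * X ^ 2 + C (A 1 1 - A 0 0) * X + C (-A 0 1) : L[X]) = 0 := by
      apply transcendental_iff_injective.mp hz
      simp only [top, bot, ← hA] at hrel
      simp only [map_add, map_mul, map_sub, map_neg, aeval_C, aeval_X, map_pow, map_zero]
      linear_combination -hrel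
    have c2 := congrArg (fun q => coeff q 2) hpoly
    have c1 := congrArg (fun q => coeff q 1) hpoly
    have c0 := congrArg (fun q => coeff q 0) hpoly
    simp [coeff_X, coeff_C] at c2 c1 c0
    ext i j
    fin_cases i <;> fin_cases j <;> simp [c2, c0, sub_eq_zero.mp c1]
  obtain ⟨β, hβ⟩ := matrix_pow_char_scalar p M m _ hscalar
  obtain ⟨ν, h3, h4⟩ := key p
  simp only [top, bot, hβ] at h3 h4
  simp only [Matrix.scalar_apply, Matrix.diagonal_apply_eq, ne_eq, zero_ne_one, one_ne_zero,
    not_false_eq_true, Matrix.diagonal_apply_ne, map_zero, zero_mul, zero_add, add_zero] at h3 h4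
  have hfix : (g ^ p) z = z := by rw [← h3, ← mul_assoc, h4, one_mul]
  ext x
  have hx : x ∈ IntermediateField.adjoin L {z} := hgen ▸ IntermediateField.mem_top
  induction hx using IntermediateField.adjoin_induction with
  | mem y hy => rw [Set.mem_singleton_iff.mp hy, hfix]; rfl
  | algebraMap y => rw [AlgHom.commutes, AlgHom.commutes]
  | add y y' _ _ h h' => rw [map_add, map_add, h, h']
  | inv y _ h => rw [map_inv₀, map_inv₀, h]
  | mul y y' _ _ h h' => rw [map_mul, map_mul, h, h']

end Mobius

/-- Automorphisms of `p`-power order of a field `F = K(w)` preserving `K = k(t)`. -/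
theorem ringHom_pow_char_sq_eq_one {k K F : Type*} [Field k] [Field K] [Field F] [Algebra k K]
    [Algebra K F] (p : ℕ) [Fact p.Prime] [CharP k p] {t : K} (ht : Transcendental k t)
    (hK : IntermediateField.adjoin k {t} = ⊤) {w : F} (hw : Transcendental K w)
    (hF : IntermediateField.adjoin K {w} = ⊤) (φ : F →+* F) (ψ : K →ₐ[k] K)
    (hφψ : ∀ x, φ (algebraMap K F x) = algebraMap K F (ψ x)) (s : ℕ) (hs : φ ^ p ^ s = 1) :
    φ ^ p ^ 2 = 1 := by
  have : CharP K p := charP_of_injective_algebraMap (algebraMap k K).injective p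
  have hpow : ∀ n x, (φ ^ n) (algebraMap K F x) = algebraMap K F ((ψ ^ n) x) := by
    intro n
    induction n with
    | zero => intro x; rfl
    | succ n ih =>
      intro x
      rw [pow_succ, pow_succ, RingHom.mul_def, RingHom.comp_apply, hφψ, ih, AlgHom.mul_apply]
  have hψs : ψ ^ p ^ s = 1 := by
    ext x
    apply (algebraMap K F).injective
    rw [← hpow, hs]
    rfl
  have hψ : ψ ^ p = 1 := algHom_pow_char_eq_one p ht hK ψ s hψs
  have hcomm : ∀ x, (φ ^ p) (algebraMap K F x) = algebraMap K F x := fun x => by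
    rw [hpow, hψ]
    rfl
  -- Since `ψ ^ p = 1`, the map `φ ^ p` is linear over `K`, and the Möbius argument applies again
  -- with `K` as ground field.
  let g : F →ₐ[K] F := { toRingHom := φ ^ p, commutes' := hcomm }
  have hg : ∀ n x, (g ^ n) x = (φ ^ (p * n)) x := by
    intro n
    induction n with
    | zero => intro x; rfl
    | succ n ih =>
      intro x
      rw [pow_succ, AlgHom.mul_apply, ih, mul_add, mul_one, pow_add]
      rfl
  have hgs : g ^ p ^ s = 1 := by
    ext x
    rw [hg, mul_comm, pow_mul, hs, one_pow]
    rfl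
  have := algHom_pow_char_eq_one p hw hF g s hgs
  ext x
  rw [pow_two, ← hg, this]
  rfl

/-! ### Tsen's theorem for conics over `k(t)` -/

section Tsen

open MvPolynomial in
/-- The ideal of the origin of affine `n`-space has height at least `n`. -/
theorem card_le_height_vanishingIdeal_zero {k σ : Type*} [Field k] [IsAlgClosed k] [Finite σ] :
    (Nat.card σ : ℕ∞) ≤ (vanishingIdeal k {(0 : σ → k)} : Ideal (MvPolynomial σ k)).height := by
  have hdim : ringKrullDim (MvPolynomial σ k) = Nat.card σ := by simp
  have : FiniteRingKrullDim (MvPolynomial σ k) := by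
    rw [finiteRingKrullDim_iff_ne_bot_and_top, hdim]
    exact ⟨by simp, fun h => ENat.natCast_ne_top _ (WithBot.coe_injective h)⟩
  obtain ⟨m, hm, hh⟩ := Ideal.exists_isMaximal_height (R := MvPolynomial σ k)
  obtain ⟨x, rfl⟩ := eq_vanishingIdeal_singleton_of_isMaximal k hm
  -- Some maximal ideal has height equal to the dimension. By the Nullstellensatz it is the ideal of
  -- a point `x`, which a translation moves to the origin.
  let e : MvPolynomial σ k ≃ₐ[k] MvPolynomial σ k := AlgEquiv.ofAlgHom
    (aeval fun i => X i + C (x i)) (aeval fun i => X i - C (x i))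
    (by ext i; simp) (by ext i; simp)
  have hcomap : (vanishingIdeal k {(0 : σ → k)} : Ideal (MvPolynomial σ k)).comap
      e.toRingEquiv = vanishingIdeal k {x} := by
    ext p
    rw [Ideal.mem_comap, mem_vanishingIdeal_singleton_iff, mem_vanishingIdeal_singleton_iff]
    have : (aeval (0 : σ → k)).comp (e : MvPolynomial σ k →ₐ[k] MvPolynomial σ k) = aeval x := by
      ext i; simp [e]
    rw [← this]
    rfl
  rw [← e.toRingEquiv.height_comap, hcomap]
  rw [hdim] at hh
  exact (WithBot.coe_injective hh).ge

open MvPolynomial in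
/-- Over an algebraically closed field, fewer than `n` polynomials in `n` variables without
constant term have a common zero different from the origin. -/
theorem exists_common_zero_ne_zero {k σ : Type*} [Field k] [IsAlgClosed k] [Finite σ]
    (s : Finset (MvPolynomial σ k)) (hs : s.card < Nat.card σ)
    (h0 : ∀ g ∈ s, aeval (0 : σ → k) g = 0) :
    ∃ x : σ → k, x ≠ 0 ∧ ∀ g ∈ s, aeval x g = 0 := by
  by_contra! hcon
  let I : Ideal (MvPolynomial σ k) := Ideal.span s
  have hZ : zeroLocus k I = {(0 : σ → k)} := by
    ext x
    rw [zeroLocus_span]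
    constructor
    · intro hx
      by_contra hne
      obtain ⟨g, hg, hgx⟩ := hcon x hne
      exact hgx (hx g hg)
    · rintro rfl g hg
      exact h0 g hg
  have hrad := vanishingIdeal_zeroLocus_eq_radical (K := k) I
  rw [hZ] at hrad
  -- If the origin is the only zero, its ideal is the radical of `I`, hence a minimal prime over
  -- `I`. Krull's height theorem then bounds its height by the number of generators, which is too
  -- small.
  have hmin : vanishingIdeal k {(0 : σ → k)} ∈ I.minimalPrimes := by
    refine ⟨⟨inferInstance, hrad ▸ Ideal.le_radical⟩, fun J hJ _ => ?_⟩
    rw [hrad]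
    exact hJ.1.radical_le_iff.mpr hJ.2
  have h1 := Ideal.height_le_spanRank_toENat_of_mem_minimalPrimes I _ hmin
  have h2 : I.spanRank.toENat ≤ s.card := by
    have : I.spanRank ≤ (s.card : Cardinal) := by
      simpa using Submodule.spanRank_span_le_card (R := MvPolynomial σ k)
        (s : Set (MvPolynomial σ k))
    simpa using OrderHomClass.mono Cardinal.toENat this
  have h3 := (card_le_height_vanishingIdeal_zero (k := k) (σ := σ)).trans (h1.trans h2)
  exact absurd (by exact_mod_cast h3) (not_le.mpr hs)

open Polynomial in
/-- **Tsen's theorem** for ternary quadratic forms over `k(t)`, `k` algebraically closed. -/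
theorem exists_isotropic {k K : Type*} [Field k] [IsAlgClosed k] [Field K] [Algebra k K] {t : K}
    (ht : Transcendental k t) (hK : IntermediateField.adjoin k {t} = ⊤)
    (c : Fin 3 → Fin 3 → K) : ∃ b : Fin 3 → K, b ≠ 0 ∧ ∑ i, ∑ j, c i j * b i * b j = 0 := by
  have hinj := transcendental_iff_injective.mp ht
  have hfrac : ∀ x : K, ∃ P Q : k[X], Q ≠ 0 ∧ x * aeval t Q = aeval t P := by
    intro x
    have hx : x ∈ IntermediateField.adjoin k {t} := hK ▸ IntermediateField.mem_top
    obtain ⟨r, s, rfl⟩ := IntermediateField.mem_adjoin_simple_iff k x |>.mp hx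
    -- With `s = 0` the quotient is `0` by the convention on division by zero.
    by_cases hs : s = 0
    · exact ⟨0, 1, one_ne_zero, by simp [hs]⟩
    · refine ⟨r, s, hs, div_mul_cancel₀ _ fun h => hs (hinj ?_)⟩
      rw [h, map_zero]
  choose P₀ Q hQ hPQ using fun i j => hfrac (c i j)
  let D : k[X] := ∏ ij : Fin 3 × Fin 3, Q ij.1 ij.2
  have hD : D ≠ 0 := Finset.prod_ne_zero_iff.mpr fun ij _ => hQ _ _
  have hclear : ∀ i j, ∃ P : k[X], c i j * aeval t D = aeval t P := by
    intro i j
    obtain ⟨R, hR⟩ := Finset.dvd_prod_of_mem (fun ij : Fin 3 × Fin 3 => Q ij.1 ij.2)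
      (Finset.mem_univ (i, j))
    refine ⟨P₀ i j * R, ?_⟩
    change c i j * aeval t (∏ ij : Fin 3 × Fin 3, Q ij.1 ij.2) = _
    rw [hR, map_mul, ← mul_assoc, hPQ, map_mul]
  choose P hP using hclear
  let d : ℕ := Finset.univ.sup fun ij : Fin 3 × Fin 3 => (P ij.1 ij.2).natDegree
  have hd : ∀ i j, (P i j).natDegree ≤ d := fun i j =>
    Finset.le_sup (f := fun ij : Fin 3 × Fin 3 => (P ij.1 ij.2).natDegree) (Finset.mem_univ (i, j))
  -- The unknowns are the coefficients of three polynomials of degree at most `d`, so there are `3d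
  -- + 3` of them. The value of the form has degree at most `3d`, and its vanishing amounts to `3d +
  -- 1` equations without constant term.
  let σ := Fin 3 × Fin (d + 1)
  let ξ : Fin 3 → (MvPolynomial σ k)[X] := fun i =>
    ∑ s : Fin (d + 1), C (MvPolynomial.X (i, s)) * X ^ (s : ℕ)
  have hξ : ∀ i, (ξ i).natDegree ≤ d := fun i =>
    natDegree_sum_le_of_forall_le _ _ fun s _ =>
      (natDegree_C_mul_X_pow_le _ _).trans (Nat.lt_succ_iff.mp s.2)
  let G : (MvPolynomial σ k)[X] :=
    ∑ i, ∑ j, (P i j).map MvPolynomial.C * ξ i * ξ j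
  have hG : G.natDegree ≤ 3 * d := by
    refine natDegree_sum_le_of_forall_le _ _ fun i _ =>
      natDegree_sum_le_of_forall_le _ _ fun j _ => ?_
    refine natDegree_mul_le.trans ((add_le_add natDegree_mul_le le_rfl).trans ?_)
    have h1 := natDegree_map_le (f := (MvPolynomial.C : k →+* MvPolynomial σ k)) (p := P i j)
    have h2 := hd i j
    have h3 := hξ i
    have h4 := hξ j
    omega
  have hξmap : ∀ (x : σ → k) (i : Fin 3),
      (ξ i).map (MvPolynomial.aeval x : MvPolynomial σ k →ₐ[k] k).toRingHom =
        ∑ s : Fin (d + 1), C (x (i, s)) * X ^ (s : ℕ) := fun x i => by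
    simp [ξ, Polynomial.map_sum]
  have hGmap : ∀ x : σ → k, G.map (MvPolynomial.aeval x : MvPolynomial σ k →ₐ[k] k).toRingHom =
      ∑ i, ∑ j, P i j * (∑ s : Fin (d + 1), C (x (i, s)) * X ^ (s : ℕ)) *
        ∑ s : Fin (d + 1), C (x (j, s)) * X ^ (s : ℕ) := fun x => by
    have h1 : (MvPolynomial.aeval x : MvPolynomial σ k →ₐ[k] k).toRingHom.comp
        MvPolynomial.C = RingHom.id k := by
      ext a; simp
    simp only [G, Polynomial.map_sum, Polynomial.map_mul, hξmap, Polynomial.map_map, h1,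
      Polynomial.map_id]
  classical
  obtain ⟨x, hx0, hx⟩ := exists_common_zero_ne_zero
    ((Finset.range (3 * d + 1)).image fun e => G.coeff e)
    (Finset.card_image_le.trans_lt (by simp [σ]; omega)) (by
      intro g hg
      obtain ⟨e, -, rfl⟩ := Finset.mem_image.mp hg
      have h1 := congrArg (fun q => coeff q e) (hGmap 0)
      simpa using h1)
  have hG0 : G.map (MvPolynomial.aeval x : MvPolynomial σ k →ₐ[k] k).toRingHom = 0 := by
    ext e
    rw [coeff_map, coeff_zero]
    by_cases he : e < 3 * d + 1
    · exact hx _ (Finset.mem_image_of_mem _ (Finset.mem_range.mpr he))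
    · rw [coeff_eq_zero_of_natDegree_lt (by omega), map_zero]
  let ζ : Fin 3 → k[X] := fun i => ∑ s : Fin (d + 1), C (x (i, s)) * X ^ (s : ℕ)
  have hsum : ∑ i, ∑ j, P i j * ζ i * ζ j = 0 := (hGmap x).symm.trans hG0
  refine ⟨fun i => aeval t (ζ i), fun h => hx0 ?_, ?_⟩
  · ext ⟨i, s⟩
    have h1 : ζ i = 0 := hinj ((congrFun h i).trans (map_zero _).symm)
    have h2 := congrArg (fun q => coeff q (s : ℕ)) h1
    simpa [ζ, finsetSum_coeff, coeff_C_mul, coeff_X_pow, Fin.val_inj] using h2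
  · have hDt : aeval t D ≠ 0 := fun h => hD (hinj (h.trans (map_zero _).symm))
    apply mul_left_cancel₀ hDt
    rw [mul_zero, ← map_zero (aeval (R := k) t), ← hsum, Finset.mul_sum, map_sum]
    refine Finset.sum_congr rfl fun i _ => ?_
    rw [Finset.mul_sum, map_sum]
    refine Finset.sum_congr rfl fun j _ => ?_
    rw [map_mul, map_mul, ← hP]
    ring

open MvPolynomial in
/-- A quadratic form is given by a matrix of coefficients. -/
theorem exists_eq_sum_of_isHomogeneous_two {R σ : Type*} [CommRing R] [Fintype σ]
    {q : MvPolynomial σ R} (hq : q.IsHomogeneous 2) :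
    ∃ c : σ → σ → R, q = ∑ i, ∑ j, C (c i j) * X i * X j := by
  classical
  have hone : ∀ m : σ →₀ ℕ, ∀ n, m.degree = n + 1 →
      ∃ i m', m = Finsupp.single i 1 + m' ∧ m'.degree = n := by
    intro m n hm
    have h0 : m ≠ 0 := by rintro rfl; simp at hm
    obtain ⟨i, hi⟩ := Finsupp.ne_iff.mp h0
    have hle : Finsupp.single i 1 ≤ m := by
      rw [Finsupp.single_le_iff]
      exact Nat.one_le_iff_ne_zero.mpr hi
    refine ⟨i, m - Finsupp.single i 1, (add_tsub_cancel_of_le hle).symm, ?_⟩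
    have := congrArg Finsupp.degree (add_tsub_cancel_of_le hle)
    rw [map_add, Finsupp.degree_single] at this
    omega
  rw [q.as_sum]
  refine Finset.sum_induction _ (fun q => ∃ c : σ → σ → R, q = ∑ i, ∑ j, C (c i j) * X i * X j)
    ?_ ⟨0, by simp⟩ ?_
  · rintro _ _ ⟨c, rfl⟩ ⟨c', rfl⟩
    exact ⟨c + c', by simp [add_mul, Finset.sum_add_distrib]⟩
  · intro m hm
    have hdeg : m.degree = 2 := by
      have := hq (mem_support_iff.mp hm)
      rwa [Finsupp.degree_eq_weight_one]
    obtain ⟨i, m', rfl, h'⟩ := hone m 1 hdeg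
    obtain ⟨j, m'', rfl, h''⟩ := hone m' 0 h'
    rw [Finsupp.degree_eq_zero_iff] at h''
    subst h''
    -- The whole coefficient is placed at one ordered pair. The matrix need not be symmetric, so
    -- nothing is divided by two and characteristic two is allowed.
    refine ⟨fun a b => if a = i ∧ b = j then
      coeff (Finsupp.single i 1 + (Finsupp.single j 1 + 0)) q else 0, ?_⟩
    rw [Finset.sum_eq_single i, Finset.sum_eq_single j]
    · simp [X, C_mul_monomial, monomial_mul]
    · intro b _ hb
      simp [hb]
    · simp
    · intro a _ ha
      simp [ha]
    · simp

end Tsen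

/-! ### Local rings and function fields of conics at a rational point -/

section LocalRing

/-- The value at `(x, y)` of the polynomial of degree two without constant term with
coefficients `l` and `r`. -/
def conicEval {K T : Type*} [Field K] [CommRing T] [Algebra K T] (l : Fin 2 → K) (r : Fin 3 → K)
    (x y : T) : T :=
  algebraMap K T (l 0) * x + algebraMap K T (l 1) * y + algebraMap K T (r 0) * x ^ 2 +
    algebraMap K T (r 1) * x * y + algebraMap K T (r 2) * y ^ 2

/-- The coordinate ring of an affine plane conic through the origin, by its universal property. -/
structure IsConicRing {K B : Type u} [Field K] [CommRing B] [Algebra K B] (l : Fin 2 → K)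
    (r : Fin 3 → K) (x y : B) : Prop where
  adjoin_eq_top : Algebra.adjoin K {x, y} = ⊤
  eval_eq_zero : conicEval l r x y = 0
  exists_lift : ∀ (T : Type u) [CommRing T] [Algebra K T] (x' y' : T), conicEval l r x' y' = 0 →
    ∃ h : B →ₐ[K] T, h x = x' ∧ h y = y'

variable {k K B S F : Type u} [Field k] [Field K] [CommRing B] [CommRing S] [Field F]
  [Algebra k K] [Algebra K B] [Algebra B S] [Algebra K S] [IsScalarTower K B S] [Algebra k S]
  [IsScalarTower k K S] {l : Fin 2 → K} {r : Fin 3 → K} {x y : B}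

theorem conicEval_map {T T' : Type*} [CommRing T] [Algebra K T] [CommRing T'] [Algebra K T']
    (h : T →ₐ[K] T') (x y : T) : h (conicEval l r x y) = conicEval l r (h x) (h y) := by
  simp [conicEval]

/-- Homomorphisms out of the local ring of a conic at the origin. -/
theorem IsConicRing.exists_lift_localization (hB : IsConicRing l r x y) (e : B →ₐ[K] K)
    (hx : e x = 0) (hy : e y = 0) {M : Submonoid B} [IsLocalization M S]
    (hM : ∀ b ∈ M, e b ≠ 0)
    {T : Type u} [CommRing T] [Algebra K T] (ε : T →ₐ[K] K) [IsLocalHom ε] (x' y' : T)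
    (hx' : ε x' = 0) (hy' : ε y' = 0) (h0 : conicEval l r x' y' = 0) :
    ∃ h : S →ₐ[K] T, h (algebraMap B S x) = x' ∧ h (algebraMap B S y) = y' := by
  obtain ⟨g, hgx, hgy⟩ := hB.exists_lift T x' y' h0
  -- Both maps kill `x` and `y`, which generate `B`. Hence `g` sends `M` to elements on which `ε` is
  -- nonzero, and these are units because `ε` is local.
  have hε : ε.comp g = e := by
    apply AlgHom.ext_of_adjoin_eq_top hB.adjoin_eq_top
    rintro z (rfl | rfl)
    · rw [AlgHom.comp_apply, hgx, hx', hx]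
    · rw [AlgHom.comp_apply, hgy, hy', hy]
  have hunit : ∀ b : M, IsUnit (g b) := by
    intro b
    apply isUnit_of_map_unit ε
    rw [← AlgHom.comp_apply, hε]
    exact IsUnit.mk0 _ (hM b b.2)
  refine ⟨IsLocalization.liftAlgHom (M := M) (f := g) hunit, ?_, ?_⟩
  · simp [hgx]
  · simp [hgy]

open Polynomial in
/-- A conic whose local ring at a rational point is formally smooth over a subfield of the
ground field is not singular at that point. -/
theorem IsConicRing.linear_ne_zero (hB : IsConicRing l r x y) (e : B →ₐ[K] K)
    (hx : e x = 0) (hy : e y = 0) {M : Submonoid B} [IsLocalization M S]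
    (hM : ∀ b ∈ M, e b ≠ 0)
    [Algebra.FormallySmooth k S] (hlr : l ≠ 0 ∨ r ≠ 0) : l ≠ 0 := by
  rintro rfl
  have hr : r ≠ 0 := hlr.resolve_left fun h => h rfl
  -- Without a linear part, every direction `(α, β)` gives a solution `(ατ, βτ)` modulo `τ ^ 2`.
  -- Formal smoothness lifts it to a solution modulo `τ ^ 3`, where the equation reads `r(α, β) τ ^
  -- 2 = 0`. A direction with `r(α, β) ≠ 0` yields the contradiction.
  obtain ⟨α, β, hαβ⟩ : ∃ α β : K, r 0 * α ^ 2 + r 1 * α * β + r 2 * β ^ 2 ≠ 0 := by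
    by_contra! h
    have h0 := h 1 0
    have h2 := h 0 1
    have h1 := h 1 1
    simp only [one_pow, mul_one, ne_eq, OfNat.ofNat_ne_zero, not_false_eq_true, zero_pow, mul_zero,
      add_zero, zero_add] at h0 h1 h2
    rw [h0, h2, zero_add, add_zero] at h1
    apply hr
    ext i
    fin_cases i <;> assumption
  let T := AdjoinRoot (X ^ 3 : K[X])
  let τ : T := AdjoinRoot.root _
  have hτ3 : τ ^ 3 = 0 := by
    have := AdjoinRoot.eval₂_root (X ^ 3 : K[X])
    simpa using this
  have hτ2 : τ ^ 2 ≠ 0 := by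
    intro h
    have h1 : AdjoinRoot.mk (X ^ 3 : K[X]) (X ^ 2) = 0 := by simpa [τ] using h
    rw [AdjoinRoot.mk_eq_zero, X_pow_dvd_iff] at h1
    simpa using h1 2 (by norm_num)
  let I : Ideal T := Ideal.span {τ ^ 2}
  have hI : I ^ 2 = ⊥ := by
    rw [Ideal.span_singleton_pow, Ideal.span_singleton_eq_bot, ← pow_mul]
    exact pow_eq_zero_of_le (by norm_num) hτ3
  let ε₀ : T →ₐ[K] K := AdjoinRoot.liftAlgHom _ (Algebra.ofId K K) 0 (by simp)
  have hε₀τ : ε₀ τ = 0 := AdjoinRoot.liftAlgHom_root ..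
  let ε : T ⧸ I →ₐ[K] K := Ideal.Quotient.liftₐ I ε₀ (by
    intro a ha
    obtain ⟨b, rfl⟩ := Ideal.mem_span_singleton.mp ha
    rw [map_mul, map_pow, hε₀τ]
    simp)
  have hετ : ε (Ideal.Quotient.mk I τ) = 0 := hε₀τ
  have hnil : IsNilpotent (Ideal.Quotient.mk I τ) := ⟨3, by rw [← map_pow, hτ3, map_zero]⟩
  have hloc : IsLocalHom ε := by
    constructor
    intro a ha
    obtain ⟨a, rfl⟩ := Ideal.Quotient.mk_surjective a
    obtain ⟨f, rfl⟩ := AdjoinRoot.mk_surjective a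
    obtain ⟨f₁, hf₁⟩ : X ∣ f - C (f.coeff 0) := by simp [X_dvd_iff]
    have h1 : f = X * f₁ + C (f.coeff 0) := by rw [← hf₁]; ring
    have h2 : Ideal.Quotient.mk I (AdjoinRoot.mk (X ^ 3 : K[X]) f) =
        Ideal.Quotient.mk I τ * Ideal.Quotient.mk I (AdjoinRoot.mk (X ^ 3 : K[X]) f₁) +
          algebraMap K (T ⧸ I) (f.coeff 0) := by
      conv_lhs => rw [h1, map_add, map_add, map_mul, map_mul]
      rfl
    rw [h2, map_add, map_mul, hετ, zero_mul, zero_add, AlgHom.commutes] at ha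
    rw [h2]
    exact ((Commute.all _ _).isNilpotent_mul_right hnil).isUnit_add_right_of_commute (ha.map _) (Commute.all _ _)
  have hτ2I : Ideal.Quotient.mk I τ ^ 2 = 0 := by
    rw [← map_pow, Ideal.Quotient.eq_zero_iff_mem]
    exact Ideal.mem_span_singleton_self _
  obtain ⟨h, hhx, hhy⟩ := hB.exists_lift_localization (S := S) e hx hy hM ε
    (algebraMap K _ α * Ideal.Quotient.mk I τ) (algebraMap K _ β * Ideal.Quotient.mk I τ)
    (by rw [map_mul, hετ, mul_zero]) (by rw [map_mul, hετ, mul_zero]) (by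
      simp only [conicEval, Pi.zero_apply, map_zero]
      linear_combination (algebraMap K (T ⧸ I) (r 0) * algebraMap K _ α ^ 2 +
        algebraMap K _ (r 1) * algebraMap K _ α * algebraMap K _ β +
        algebraMap K _ (r 2) * algebraMap K _ β ^ 2) * hτ2I)
  obtain ⟨ψ, hψ⟩ := Algebra.FormallySmooth.exists_lift (R := k) (A := S) I ⟨2, hI⟩
    (h.restrictScalars k)
  have hψ' : ∀ s, Ideal.Quotient.mk I (ψ s) = h s := fun s => by
    simpa using DFunLike.congr_fun hψ s
  have hdiff : ∀ (s : S) (a : T), h s = Ideal.Quotient.mk I a → ∃ b, ψ s = a + τ ^ 2 * b := by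
    intro s a hsa
    rw [← hψ', Ideal.Quotient.eq] at hsa
    obtain ⟨b, hb⟩ := Ideal.mem_span_singleton.mp hsa
    exact ⟨b, by rw [← hb]; ring⟩
  obtain ⟨x₁, hx₁⟩ := hdiff (algebraMap B S x) (algebraMap K T α * τ) hhx
  obtain ⟨y₁, hy₁⟩ := hdiff (algebraMap B S y) (algebraMap K T β * τ) hhy
  -- The lift is linear over `k` only, so it may move elements of `K` by multiples of `τ ^ 2`. This
  -- is harmless: the coefficients of `r` multiply terms already divisible by `τ ^ 2`.
  have hc : ∀ a : K, ∃ b, ψ (algebraMap K S a) = algebraMap K T a + τ ^ 2 * b := fun a =>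
    hdiff _ _ (by rw [AlgHom.commutes]; rfl)
  obtain ⟨r₀, hr₀⟩ := hc (r 0)
  obtain ⟨r₁, hr₁⟩ := hc (r 1)
  obtain ⟨r₂, hr₂⟩ := hc (r 2)
  have hrel := congrArg (algebraMap B S) hB.eval_eq_zero
  simp only [conicEval, Pi.zero_apply, map_zero, zero_mul, zero_add, map_add, map_mul, map_pow,
    ← IsScalarTower.algebraMap_apply] at hrel
  have hrel' := congrArg ψ hrel
  simp only [map_add, map_mul, map_pow, map_zero, hx₁, hy₁, hr₀, hr₁, hr₂] at hrel'
  apply hτ2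
  have hu : IsUnit (algebraMap K T (r 0 * α ^ 2 + r 1 * α * β + r 2 * β ^ 2)) :=
    (IsUnit.mk0 _ hαβ).map _
  rw [← hu.mul_right_eq_zero]
  simp only [map_add, map_mul, map_pow]
  -- The cofactors of `τ ^ 3` in the three quadratic monomials of the lifted coordinates.
  let u₀ : T := 2 * algebraMap K T α * x₁ + τ * x₁ ^ 2
  let u₁ : T := algebraMap K T α * y₁ + algebraMap K T β * x₁ + τ * x₁ * y₁
  let u₂ : T := 2 * algebraMap K T β * y₁ + τ * y₁ ^ 2
  linear_combination hrel' - (algebraMap K T (r 0) * u₀ + τ * r₀ * algebraMap K T α ^ 2 +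
    τ ^ 2 * r₀ * u₀ + algebraMap K T (r 1) * u₁ + τ * r₁ * algebraMap K T α * algebraMap K T β +
    τ ^ 2 * r₁ * u₁ + algebraMap K T (r 2) * u₂ + τ * r₂ * algebraMap K T β ^ 2 +
    τ ^ 2 * r₂ * u₂) * hτ3

/-- The local ring of a conic at a rational point is not a field. -/
theorem IsConicRing.not_isField (hB : IsConicRing l r x y) (e : B →ₐ[K] K)
    (hx : e x = 0) (hy : e y = 0) {M : Submonoid B} [IsLocalization M S]
    (hM : ∀ b ∈ M, e b ≠ 0) :
    ¬ IsField S := by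
  intro hS
  -- A nonzero tangent vector gives a homomorphism from `S` to the dual numbers whose image contains
  -- a nonzero element of square zero. This is impossible if `S` is a field, since the homomorphism
  -- would be injective.
  obtain ⟨α, β, hαβ, h0⟩ : ∃ α β : K, (α ≠ 0 ∨ β ≠ 0) ∧ l 0 * α + l 1 * β = 0 := by
    by_cases h : l 1 = 0
    · refine ⟨0, 1, by simp, by simp [h]⟩
    · exact ⟨l 1, -l 0, Or.inl h, by ring⟩
  have hloc : IsLocalHom (TrivSqZeroExt.fstHom K K K) :=
    ⟨fun a ha => TrivSqZeroExt.isUnit_iff_isUnit_fst.mpr ha⟩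
  have hsq : ∀ a b : K, (TrivSqZeroExt.inr a * TrivSqZeroExt.inr b : TrivSqZeroExt K K) = 0 :=
    fun a b => TrivSqZeroExt.inr_mul_inr K a b
  obtain ⟨h, hhx, hhy⟩ := hB.exists_lift_localization (S := S) e hx hy hM
    (TrivSqZeroExt.fstHom K K K) (TrivSqZeroExt.inr α) (TrivSqZeroExt.inr β) (by simp) (by simp)
    (by
      simp only [conicEval, pow_two, mul_assoc, hsq, mul_zero, add_zero]
      ext
      · simp
      · simpa [TrivSqZeroExt.algebraMap_eq_inl, mul_comm] using h0)
  let : Field S := hS.toField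
  have hinj := (h : S →+* TrivSqZeroExt K K).injective
  have hzero : ∀ (z : S) (a : K), h z = TrivSqZeroExt.inr a → z = 0 := by
    intro z a hz
    by_contra hne
    have h1 : h (z * z) = 0 := by rw [map_mul, hz, hsq]
    have h2 : z * z = 0 := hinj (h1.trans (map_zero h).symm)
    exact hne (mul_self_eq_zero.mp h2)
  rcases hαβ with hα | hβ
  · have := hzero _ _ hhx
    rw [this, map_zero] at hhx
    exact hα (by simpa using (congrArg TrivSqZeroExt.snd hhx).symm)
  · have := hzero _ _ hhy
    rw [this, map_zero] at hhy
    exact hβ (by simpa using (congrArg TrivSqZeroExt.snd hhy).symm)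

/-- A field generated by a point of a plane conic with a nonsingular rational point is
a simple extension. -/
theorem exists_adjoin_eq_top_of_conicEval {K F : Type*} [Field K] [Field F] [Algebra K F]
    {l : Fin 2 → K} {r : Fin 3 → K} (hl : l ≠ 0) {x y : F} (h0 : conicEval l r x y = 0)
    (hgen : IntermediateField.adjoin K {x, y} = ⊤) :
    ∃ w : F, IntermediateField.adjoin K {w} = ⊤ := by
  have hsuff : ∀ w, x ∈ IntermediateField.adjoin K {w} → y ∈ IntermediateField.adjoin K {w} →
      ∃ w : F, IntermediateField.adjoin K {w} = ⊤ := fun w hx hy => by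
    refine ⟨w, top_le_iff.mp ?_⟩
    rw [← hgen, IntermediateField.adjoin_le_iff]
    rintro z (rfl | rfl)
    exacts [hx, hy]
  have hself : ∀ w : F, w ∈ IntermediateField.adjoin K {w} := fun w =>
    IntermediateField.mem_adjoin_simple_self K w
  have hmap : ∀ (w : F) (a : K), algebraMap K F a ∈ IntermediateField.adjoin K {w} := fun w a =>
    (IntermediateField.adjoin K {w}).algebraMap_mem a
  by_cases hx : x = 0
  · exact hsuff y (hx ▸ zero_mem _) (hself y)
  -- Projection from the origin: `z` is the slope of the line through the origin and `(x, y)`.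
  -- Dividing the equation by `x` leaves one that is linear in `x` over `K(z)`.
  let z := y / x
  have hy : y = z * x := (div_mul_cancel₀ y hx).symm
  let A := algebraMap K F (l 0) + algebraMap K F (l 1) * z
  let D := algebraMap K F (r 0) + algebraMap K F (r 1) * z + algebraMap K F (r 2) * z ^ 2
  have hAD : A + D * x = 0 := by
    apply mul_left_cancel₀ hx
    rw [mul_zero, ← h0, conicEval, hy]
    ring
  -- In the degenerate case the point lies on a line through the origin with constant slope, and `x`
  -- generates. This is where the nonvanishing of `l` enters.
  by_cases hD : D = 0
  · have hA : A = 0 := by rwa [hD, zero_mul, add_zero] at hAD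
    have hl1 : l 1 ≠ 0 := by
      intro h1
      apply hl
      have hl0 : l 0 = 0 := by simpa [A, h1] using hA
      ext i
      fin_cases i <;> assumption
    have hz : z = algebraMap K F (-(l 0) / l 1) := by
      have : algebraMap K F (l 1) ≠ 0 := by simpa using hl1
      rw [map_div₀, eq_div_iff this, map_neg]
      linear_combination hA
    refine hsuff x (hself x) ?_
    rw [hy, hz]
    exact mul_mem (hmap _ _) (hself _)
  · have hxz : x = -A / D := by
      rw [eq_div_iff hD]
      linear_combination hAD
    have hxm : x ∈ IntermediateField.adjoin K {z} := by
      rw [hxz]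
      exact div_mem (neg_mem (add_mem (hmap _ _) (mul_mem (hmap _ _) (hself _))))
        (add_mem (add_mem (hmap _ _) (mul_mem (hmap _ _) (hself _)))
          (mul_mem (hmap _ _) (pow_mem (hself _) _)))
    refine hsuff z hxm ?_
    rw [hy]
    exact mul_mem (hself _) hxm

/-- The function field of a conic with a nonsingular rational point is a rational function field. -/
theorem IsConicRing.exists_transcendental_generator [IsDomain S] [Algebra S F] [IsFractionRing S F]
    [Algebra K F] [IsScalarTower K S F] (hB : IsConicRing l r x y) (e : B →ₐ[K] K)
    (hx : e x = 0) (hy : e y = 0) {M : Submonoid B} [IsLocalization M S]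
    (hM : ∀ b ∈ M, e b ≠ 0) (hl : l ≠ 0) :
    ∃ w : F, Transcendental K w ∧ IntermediateField.adjoin K {w} = ⊤ := by
  let : Algebra B F := ((algebraMap S F).comp (algebraMap B S)).toAlgebra
  have : IsScalarTower B S F := IsScalarTower.of_algebraMap_eq fun _ => rfl
  have : IsScalarTower K B F := IsScalarTower.of_algebraMap_eq fun a => by
    rw [IsScalarTower.algebraMap_apply B S F, ← IsScalarTower.algebraMap_apply K B S,
      ← IsScalarTower.algebraMap_apply K S F]
  have hgen : IntermediateField.adjoin K {algebraMap B F x, algebraMap B F y} = ⊤ := by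
    have hBF : ∀ b : B, algebraMap B F b ∈
        IntermediateField.adjoin K {algebraMap B F x, algebraMap B F y} := by
      intro b
      have hb : b ∈ Algebra.adjoin K {x, y} := hB.adjoin_eq_top ▸ Algebra.mem_top
      have h1 : IsScalarTower.toAlgHom K B F b ∈
          (Algebra.adjoin K {x, y}).map (IsScalarTower.toAlgHom K B F) := ⟨b, hb, rfl⟩
      rw [AlgHom.map_adjoin, Set.image_pair] at h1
      exact IntermediateField.algebra_adjoin_le_adjoin _ _ h1
    have hSF : ∀ s : S, algebraMap S F s ∈
        IntermediateField.adjoin K {algebraMap B F x, algebraMap B F y} := by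
      intro s
      obtain ⟨⟨b, c⟩, hs⟩ := IsLocalization.surj M s
      have h1 := congrArg (algebraMap S F) hs
      rw [map_mul, ← IsScalarTower.algebraMap_apply, ← IsScalarTower.algebraMap_apply] at h1
      have h2 : algebraMap B F c ≠ 0 := by
        rw [IsScalarTower.algebraMap_apply B S F]
        exact ((IsLocalization.map_units S c).map (algebraMap S F)).ne_zero
      rw [← eq_div_iff h2] at h1
      rw [h1]
      exact div_mem (hBF _) (hBF _)
    rw [eq_top_iff]
    rintro z -
    obtain ⟨a, b, -, rfl⟩ := IsFractionRing.div_surjective (A := S) z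
    exact div_mem (hSF _) (hSF _)
  have hrel : conicEval l r (algebraMap B F x) (algebraMap B F y) = 0 := by
    have := conicEval_map (l := l) (r := r) (IsScalarTower.toAlgHom K B F) x y
    rw [hB.eval_eq_zero, map_zero] at this
    exact this.symm
  obtain ⟨w, hw⟩ := exists_adjoin_eq_top_of_conicEval hl hrel hgen
  -- If `w` were algebraic, `F` would be algebraic over `K`, and the domain `S` inside it would be a
  -- field.
  refine ⟨w, fun halg => hB.not_isField (S := S) e hx hy hM ?_, hw⟩
  have halgF : Algebra.IsAlgebraic K F := by
    have h1 := IntermediateField.isAlgebraic_adjoin_simple halg.isIntegral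
    rw [hw] at h1
    exact (IntermediateField.topEquiv (F := K) (E := F)).isAlgebraic_iff.mp h1
  have halgS : Algebra.IsAlgebraic K S :=
    Algebra.IsAlgebraic.tower_bot_of_injective (IsFractionRing.injective S F)
  exact isField_of_isIntegral_of_isField' (Field.toIsField K)

end LocalRing

/-! ### Coordinate rings of the standard charts of projective space -/

section Chart

open MvPolynomial HomogeneousLocalization

variable (K : Type u) [Field K] (n : ℕ) (j : Fin (n + 1))

theorem aeval_smul_of_isHomogeneous {K T σ : Type*} [CommRing K] [CommRing T] [Algebra K T]
    {p : MvPolynomial σ K} {d : ℕ} (hp : p.IsHomogeneous d) (c : T) (b : σ → T) :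
    aeval (fun i => c * b i) p = c ^ d * aeval b p := by
  rw [aeval_def, aeval_def, eval₂_eq, eval₂_eq, Finset.mul_sum]
  refine Finset.sum_congr rfl fun m hm => ?_
  have hd : ∑ i ∈ m.support, m i = d := by
    rw [← hp (mem_support_iff.mp hm)]
    exact DFunLike.congr_fun (Finsupp.degree_eq_weight_one (R := ℕ)) m
  rw [Finset.prod_congr rfl fun i _ => mul_pow c (b i) (m i), Finset.prod_mul_distrib,
    Finset.prod_pow_eq_pow_sum, hd]
  ring

/-- Dehomogenization `p ↦ p(x₀/xⱼ, …, xₙ/xⱼ)`. -/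
noncomputable def toAway : MvPolynomial (Fin (n + 1)) K →+* Away (grading K n) (X j) :=
  eval₂Hom ((fromZeroRingHom (grading K n) _).comp (algebraMap K (grading K n 0)))
    fun i => Away.mk (grading K n) (isHomogeneous_X K j) 1 (X i)
      (by simpa using isHomogeneous_X K i)

theorem val_awayMk {d : ℕ} {p : MvPolynomial (Fin (n + 1)) K} (hp : p ∈ grading K n (d • 1)) :
    (Away.mk (grading K n) (isHomogeneous_X K j) d p hp).val = IsLocalization.Away.invSelf
      (S := Localization.Away (X j : MvPolynomial (Fin (n + 1)) K))
        (X j : MvPolynomial (Fin (n + 1)) K) ^ d *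
          algebraMap (MvPolynomial (Fin (n + 1)) K) _ p := by
  refine (Away.val_mk _ d _ p hp).trans ?_
  rw [Localization.mk_eq_mk', IsLocalization.mk'_eq_iff_eq_mul, mul_right_comm,
    map_pow, ← mul_pow, mul_comm (IsLocalization.Away.invSelf _),
    IsLocalization.Away.mul_invSelf, one_pow, one_mul]

theorem val_toAway (p : MvPolynomial (Fin (n + 1)) K) :
    (toAway K n j p).val = aeval (fun i =>
      IsLocalization.Away.invSelf (S := Localization.Away (X j : MvPolynomial (Fin (n + 1)) K))
        (X j : MvPolynomial (Fin (n + 1)) K) * algebraMap (MvPolynomial (Fin (n + 1)) K) _ (X i)) p := by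
  have : (algebraMap (Away (grading K n) (X j : MvPolynomial (Fin (n + 1)) K))
      (Localization.Away (X j : MvPolynomial (Fin (n + 1)) K))).comp (toAway K n j) =
      (aeval fun i => IsLocalization.Away.invSelf
        (S := Localization.Away (X j : MvPolynomial (Fin (n + 1)) K))
        (X j : MvPolynomial (Fin (n + 1)) K) * algebraMap (MvPolynomial (Fin (n + 1)) K) _ (X i)).toRingHom := by
    apply MvPolynomial.ringHom_ext
    · intro a
      simp only [toAway, RingHom.comp_apply, coe_eval₂Hom, eval₂_C, HomogeneousLocalization.algebraMap_apply]
      rw [AlgHom.toRingHom_eq_coe, RingHom.coe_coe, ← MvPolynomial.algebraMap_eq, AlgHom.commutes,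
        IsScalarTower.algebraMap_apply K (MvPolynomial (Fin (n + 1)) K)
          (Localization.Away (X j : MvPolynomial (Fin (n + 1)) K)),
        ← Localization.mk_one_eq_algebraMap]
      rfl
    · intro i
      simp only [toAway, RingHom.comp_apply, coe_eval₂Hom, eval₂_X]
      rw [AlgHom.toRingHom_eq_coe, RingHom.coe_coe, aeval_X]
      exact (val_awayMk K n j _).trans (by rw [pow_one])
  exact DFunLike.congr_fun this p

theorem toAway_of_isHomogeneous {d : ℕ} {p : MvPolynomial (Fin (n + 1)) K}
    (hp : p.IsHomogeneous d) : toAway K n j p =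
      Away.mk (grading K n) (isHomogeneous_X K j) d p (by simpa using hp) := by
  apply val_injective
  rw [val_toAway, aeval_smul_of_isHomogeneous hp]
  have : aeval (fun i => algebraMap _
      (Localization.Away (X j : MvPolynomial (Fin (n + 1)) K)) (X i)) p =
      algebraMap _ (Localization.Away (X j : MvPolynomial (Fin (n + 1)) K)) p :=
    (aeval_algebraMap_apply (R := K)
      (Localization.Away (X j : MvPolynomial (Fin (n + 1)) K)) X p).trans
      (by rw [aeval_X_left_apply])
  rw [this]
  exact (val_awayMk K n j _).symm

theorem toAway_surjective : Function.Surjective (toAway K n j) := by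
  intro a
  obtain ⟨d, p, hp, rfl⟩ := Away.mk_surjective _ (isHomogeneous_X K j) a
  exact ⟨p, toAway_of_isHomogeneous K n j (by simpa using hp)⟩

theorem toAway_X_self : toAway K n j (X j) = 1 := by
  apply val_injective
  rw [val_toAway, aeval_X, val_one, mul_comm, IsLocalization.Away.mul_invSelf]

/-- Since `xⱼ` goes to a unit, `h` extends to the localization, with `1 / xⱼ` going to `1`; restrict
to degree zero. With `toAway_surjective` this gives the chart the universal property of the
polynomial ring modulo `xⱼ - 1`. -/
theorem exists_lift_toAway {T : Type*} [CommRing T] (h : MvPolynomial (Fin (n + 1)) K →+* T)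
    (hj : h (X j) = 1) : ∃ h' : Away (grading K n) (X j) →+* T, h'.comp (toAway K n j) = h := by
  have hu : IsUnit (h (X j)) := hj ▸ isUnit_one
  refine ⟨(IsLocalization.Away.lift (X j) hu).comp
    (algebraMap (Away (grading K n) (X j : MvPolynomial (Fin (n + 1)) K))
      (Localization.Away (X j : MvPolynomial (Fin (n + 1)) K))), ?_⟩
  have hmk : IsLocalization.Away.lift (X j) hu (IsLocalization.Away.invSelf
      (S := Localization.Away (X j : MvPolynomial (Fin (n + 1)) K))
      (X j : MvPolynomial (Fin (n + 1)) K)) = 1 := by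
    have h2 := congrArg (IsLocalization.Away.lift (X j) hu)
      (IsLocalization.Away.mul_invSelf
        (S := Localization.Away (X j : MvPolynomial (Fin (n + 1)) K))
        (X j : MvPolynomial (Fin (n + 1)) K))
    rwa [map_mul, IsLocalization.Away.lift_eq, hj, one_mul, map_one] at h2
  apply MvPolynomial.ringHom_ext
  · intro a
    rw [RingHom.comp_apply, RingHom.comp_apply, HomogeneousLocalization.algebraMap_apply, val_toAway, ← MvPolynomial.algebraMap_eq,
      AlgHom.commutes, IsScalarTower.algebraMap_apply K (MvPolynomial (Fin (n + 1)) K),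
      IsLocalization.Away.lift_eq]
  · intro i
    rw [RingHom.comp_apply, RingHom.comp_apply, HomogeneousLocalization.algebraMap_apply, val_toAway, aeval_X,
      map_mul, hmk, one_mul, IsLocalization.Away.lift_eq]

/-- Dehomogenization with values in the sections over the chart `D₊(xⱼ)`. -/
noncomputable def toSection :
    MvPolynomial (Fin (n + 1)) K →+* Γ((projectiveSpace K n).left, (chart K n j).1) :=
  (Proj.awayToSection (grading K n) (X j)).hom.comp (toAway K n j)

theorem awayToSection_bijective :
    Function.Bijective (Proj.awayToSection (grading K n) (X j)) := by
  have : IsIso (Proj.awayToSection (grading K n) (X j)) := by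
    rw [← Proj.basicOpenIsoAway_hom (grading K n) (X j) (isHomogeneous_X K j) Nat.one_pos]
    infer_instance
  exact ConcreteCategory.bijective_of_isIso _

theorem toSection_surjective : Function.Surjective (toSection K n j) :=
  (awayToSection_bijective K n j).2.comp (toAway_surjective K n j)

theorem toSection_X_self : toSection K n j (X j) = 1 :=
  (congrArg (Proj.awayToSection (grading K n) (X j)).hom (toAway_X_self K n j)).trans (map_one _)

theorem toSection_of_isHomogeneous {d : ℕ} {p : MvPolynomial (Fin (n + 1)) K}
    (hp : p.IsHomogeneous d) : toSection K n j p = dehomogenize hp j :=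
  congrArg (Proj.awayToSection (grading K n) (X j)).hom (toAway_of_isHomogeneous K n j hp)

theorem exists_lift_toSection {T : Type*} [CommRing T] (h : MvPolynomial (Fin (n + 1)) K →+* T)
    (hj : h (X j) = 1) :
    ∃ h' : Γ((projectiveSpace K n).left, (chart K n j).1) →+* T,
      h'.comp (toSection K n j) = h := by
  obtain ⟨h', hh'⟩ := exists_lift_toAway K n j h hj
  let e := RingEquiv.ofBijective (Proj.awayToSection (grading K n) (X j)).hom
    (awayToSection_bijective K n j)
  refine ⟨h'.comp e.symm.toRingHom, ?_⟩
  rw [← hh']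
  exact RingHom.ext fun p => congrArg h' (e.symm_apply_apply _)

theorem fromSpec_basicOpen {A : Type u} [CommRing A] {τ : Type*} [SetLike τ A]
    [AddSubgroupClass τ A] (𝒜 : ℕ → τ) [GradedRing 𝒜] {f : A} {m : ℕ} (hf : f ∈ 𝒜 m)
    (hm : 0 < m) : (Proj.isAffineOpen_basicOpen 𝒜 f hf hm).fromSpec =
      Spec.map (Proj.awayToSection 𝒜 f) ≫ Proj.awayι 𝒜 f hf hm := by
  rw [← cancel_epi (Proj.isAffineOpen_basicOpen 𝒜 f hf hm).isoSpec.hom]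
  have h2 := (Proj.basicOpenIsoSpec 𝒜 f hf hm).hom_inv_id_assoc (Proj.basicOpen 𝒜 f).ι
  rw [Proj.basicOpenIsoSpec_inv_ι, Proj.basicOpenIsoSpec_hom, Proj.basicOpenToSpec,
    Category.assoc] at h2
  rw [IsAffineOpen.isoSpec_hom, IsAffineOpen.toSpecΓ_fromSpec]
  exact h2.symm

theorem fromSpec_basicOpen_toSpecZero {A : Type u} [CommRing A] {τ : Type*} [SetLike τ A]
    [AddSubgroupClass τ A] (𝒜 : ℕ → τ) [GradedRing 𝒜] {f : A} {m : ℕ} (hf : f ∈ 𝒜 m)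
    (hm : 0 < m) {R : CommRingCat.{u}} (g : R ⟶ CommRingCat.of (𝒜 0)) :
    (Proj.isAffineOpen_basicOpen 𝒜 f hf hm).fromSpec ≫ Proj.toSpecZero 𝒜 ≫ Spec.map g =
      Spec.map (g ≫ CommRingCat.ofHom (fromZeroRingHom 𝒜 _) ≫ Proj.awayToSection 𝒜 f) := by
  rw [fromSpec_basicOpen 𝒜 hf hm, Category.assoc, Proj.awayι_toSpecZero_assoc, ← Spec.map_comp,
    ← Spec.map_comp, Category.assoc]

/-- The structure morphism on a chart is given by the constants, which turns compatibilities over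
`Spec K` into statements about ring homomorphisms. -/
theorem fromSpec_chart_hom : (chart K n j).2.fromSpec ≫ (projectiveSpace K n).hom =
    Spec.map (CommRingCat.ofHom ((toSection K n j).comp C)) := by
  refine (fromSpec_basicOpen_toSpecZero (grading K n) (isHomogeneous_X K j) Nat.one_pos
    (CommRingCat.ofHom (algebraMap K (grading K n 0)))).trans (congrArg Spec.map ?_)
  apply CommRingCat.hom_ext
  refine RingHom.ext fun a => ?_
  have : toAway K n j (C a) = fromZeroRingHom (grading K n) _ (algebraMap K (grading K n 0) a) := by
    simp [toAway]
  exact (congrArg (Proj.awayToSection (grading K n) (X j)).hom this).symm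

end Chart

/-! ### The generic point and function field of the projective line -/

section ProjectiveLine

variable (k : Type u) [Field k]

/-- The generic point of projective space. -/
theorem exists_specializes_projectiveSpace (n : ℕ) (j : Fin (n + 1)) :
    ∃ η ∈ (chart k n j).1, ∀ y : (projectiveSpace k n).left, η ⤳ y := by
  have hX : MvPolynomial.X j ∉ (⊥ : HomogeneousIdeal (grading k n)) := fun h =>
    MvPolynomial.X_ne_zero (R := k) j ((Submodule.mem_bot _).mp h)
  let η : ProjectiveSpectrum (grading k n) :=
    { asHomogeneousIdeal := ⊥
      isPrime := Ideal.isPrime_bot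
      not_irrelevant_le := fun h => hX (h (by
        rw [HomogeneousIdeal.mem_irrelevant_iff, GradedRing.proj_apply]
        exact DirectSum.decompose_of_mem_ne _ (MvPolynomial.isHomogeneous_X k j) one_ne_zero)) }
  refine ⟨η, hX, fun y => ?_⟩
  exact specializes_iff_mem_closure.mpr
    ((ProjectiveSpectrum.le_iff_mem_closure (𝒜 := grading k n) η y).mp
      (show (⊥ : HomogeneousIdeal (grading k n)) ≤ _ from bot_le))

end ProjectiveLine

/-- The morphism from the spectrum of the residue field factors through an affine open. -/
theorem specMap_evaluation_fromSpec {X : Scheme.{u}} {U : X.Opens} (hU : IsAffineOpen U) (x : X)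
    (hx : x ∈ U) : Spec.map (X.evaluation U x hx) ≫ hU.fromSpec = X.fromSpecResidueField x := by
  rw [← Scheme.germ_residue, Spec.map_comp, Category.assoc, Scheme.fromSpecResidueField,
    ← hU.fromSpecStalk_eq_fromSpecStalk hx]
  rfl

/-- Elements of a residue field are quotients of values of functions on an affine open. -/
theorem exists_evaluation_eq_div {X : Scheme.{u}} {U : X.Opens} (hU : IsAffineOpen U) (x : X)
    (hx : x ∈ U) (z : X.residueField x) : ∃ a b : Γ(X, U),
      z = X.evaluation U x hx a / X.evaluation U x hx b := by
  obtain ⟨s, rfl⟩ := X.residue_surjective x z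
  have hloc := hU.isLocalization_stalk ⟨x, hx⟩
  let : Algebra Γ(X, U) (X.presheaf.stalk x) := (X.presheaf.germ U x hx).hom.toAlgebra
  have : IsLocalization.AtPrime (X.presheaf.stalk x) (hU.primeIdealOf ⟨x, hx⟩).asIdeal := hloc
  obtain ⟨⟨a, b⟩, hab⟩ := IsLocalization.surj (hU.primeIdealOf ⟨x, hx⟩).asIdeal.primeCompl s
  have hb := (IsLocalization.map_units (X.presheaf.stalk x) b).map (X.residue x).hom
  refine ⟨a, b, ?_⟩
  have h1 := congrArg (X.residue x).hom hab
  rw [map_mul] at h1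
  exact (eq_div_iff hb.ne_zero).mpr h1

open MvPolynomial in
/-- The function field of the projective line is a rational function field. -/
theorem exists_transcendental_residueField {k : Type u} [Field k]
    {η : (projectiveSpace k 1).left} (hη : ∀ y, η ⤳ y)
    [Algebra k ((projectiveSpace k 1).left.residueField η)]
    (hc : Spec.map (CommRingCat.ofHom (algebraMap k ((projectiveSpace k 1).left.residueField η))) =
      (projectiveSpace k 1).left.fromSpecResidueField η ≫ (projectiveSpace k 1).hom) :
    ∃ t : (projectiveSpace k 1).left.residueField η,
      Transcendental k t ∧ IntermediateField.adjoin k {t} = ⊤ := by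
  obtain ⟨η₀, hη₀, -⟩ := exists_specializes_projectiveSpace k 1 0
  have hopen : ∀ U : (projectiveSpace k 1).left.Opens, ∀ y ∈ U, η ∈ U := fun U y hy =>
    (hη y).mem_open U.2 hy
  have hηU := hopen _ _ hη₀
  let ev := (projectiveSpace k 1).left.evaluation (chart k 1 0).1 η hηU
  let g : MvPolynomial (Fin 2) k →+* (projectiveSpace k 1).left.residueField η :=
    ev.hom.comp (toSection k 1 0)
  have hgC : ∀ a, g (C a) = algebraMap k _ a := by
    have h1 := specMap_evaluation_fromSpec (chart k 1 0).2 η hηU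
    rw [← h1, Category.assoc, fromSpec_chart_hom, ← Spec.map_comp] at hc
    have h2 := Spec.map_injective hc
    intro a
    exact (DFunLike.congr_fun (congrArg CommRingCat.Hom.hom h2) a).symm
  let t := g (X 1)
  have hg : ∀ p, g p = aeval ![1, t] p := by
    have : g = (aeval ![1, t] : MvPolynomial (Fin 2) k →ₐ[k] _).toRingHom := by
      apply MvPolynomial.ringHom_ext
      · intro a
        simp [hgC]
      · intro i
        fin_cases i
        · have : g (X 0) = 1 :=
            (congrArg ev.hom (toSection_X_self k 1 0)).trans (map_one _)
          simpa using this
        · simp [t]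
    exact DFunLike.congr_fun this
  refine ⟨t, ?_, ?_⟩
  · rw [transcendental_iff]
    intro P hP
    -- The function `P(x₁/x₀)` vanishes at the generic point, so its nonvanishing locus is empty and
    -- it is nilpotent. Its image in the reduced ring `k[T]` is `P`, which is therefore zero.
    let s := toSection k 1 0 (Polynomial.aeval (X 1) P)
    have hs : ev s = 0 := by
      have h1 : g (Polynomial.aeval (X 1) P) = 0 := by
        rw [hg, ← hP, ← Polynomial.aeval_algHom_apply]
        simp
      exact h1
    have hbot : (projectiveSpace k 1).left.basicOpen s = ⊥ := by
      rw [eq_bot_iff]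
      intro y hy
      exact absurd hs
        (((projectiveSpace k 1).left.evaluation_ne_zero_iff_mem_basicOpen η hηU s).mpr
          (hopen _ y hy))
    have hnil : IsNilpotent s := (Scheme.isNilpotent_iff_basicOpen_eq_bot_of_isCompact
      (chart k 1 0).2.isCompact s).mpr hbot
    obtain ⟨h', hh'⟩ := exists_lift_toSection k 1 0
      (aeval ![1, Polynomial.X] : MvPolynomial (Fin 2) k →ₐ[k] Polynomial k).toRingHom (by simp)
    have h2 : h' s = P := by
      have h3 := DFunLike.congr_fun hh' (Polynomial.aeval (X 1) P)
      refine h3.trans ?_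
      change aeval ![1, Polynomial.X] (Polynomial.aeval (X 1) P) = P
      rw [← Polynomial.aeval_algHom_apply]
      simp
    rw [← h2]
    exact (hnil.map h').eq_zero
  · rw [eq_top_iff]
    rintro z -
    have hmem : ∀ a, ev a ∈ IntermediateField.adjoin k {t} := by
      intro a
      obtain ⟨p, rfl⟩ := toSection_surjective k 1 0 a
      have h1 : ev (toSection k 1 0 p) = aeval ![1, t] p := hg p
      rw [h1]
      have h2 : ∀ i, ![1, t] i ∈ IntermediateField.adjoin k {t} := by
        intro i
        fin_cases i
        · exact one_mem _
        · exact IntermediateField.mem_adjoin_simple_self k t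
      have h4 := comp_aeval_apply (R := k)
        (f := fun i => (⟨![1, t] i, h2 i⟩ : IntermediateField.adjoin k {t}))
        (IntermediateField.adjoin k {t}).val p
      rw [show aeval ![1, t] p = _ from h4.symm]
      exact SetLike.coe_mem _
    obtain ⟨a, b, rfl⟩ := exists_evaluation_eq_div (chart k 1 0).2 η hηU z
    exact div_mem (hmem a) (hmem b)

/-! ### Equations of a plane conic around a rational point -/

section ConicChart

open MvPolynomial

/-- With indices modulo three, `j + 1` and `j + 2` are the affine coordinates of the chart `D₊(xⱼ)`,
so the three charts are treated at once. -/
theorem sum_fin_three_rotate {M : Type*} [AddCommMonoid M] (f : Fin 3 → M) (j : Fin 3) :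
    ∑ i, f i = f j + f (j + 1) + f (j + 2) := by
  fin_cases j
  · simp [Fin.sum_univ_three]
  · simp only [Fin.sum_univ_three, Fin.mk_one]
    rw [show (1 : Fin 3) + 1 = 2 from rfl, show (1 : Fin 3) + 2 = 0 from rfl]
    abel
  · simp only [Fin.sum_univ_three, Fin.reduceFinMk]
    rw [show (2 : Fin 3) + 1 = 0 from rfl, show (2 : Fin 3) + 2 = 1 from rfl]
    abel

/-- The affine chart around a rational point of a plane conic is a conic ring. -/
theorem exists_isConicRing {K B : Type u} [Field K] [CommRing B] [Algebra K B]
    (c : Fin 3 → Fin 3 → K) {q : MvPolynomial (Fin 3) K}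
    (hc : q = ∑ i, ∑ j, C (c i j) * X i * X j) (hq : q ≠ 0) (j : Fin 3) (a : Fin 3 → K)
    (haj : a j = 1) (ha : ∑ i, ∑ j, c i j * a i * a j = 0) (ρ : MvPolynomial (Fin 3) K →ₐ[K] B)
    (hρ : Function.Surjective ρ) (hρj : ρ (X j) = 1) (hρq : ρ q = 0)
    (hlift : ∀ (T : Type u) [CommRing T] [Algebra K T] (h : MvPolynomial (Fin 3) K →ₐ[K] T),
      h (X j) = 1 → h q = 0 → ∃ h' : B →ₐ[K] T, h'.comp ρ = h) :
    ∃ (l : Fin 2 → K) (r : Fin 3 → K) (x y : B) (e : B →ₐ[K] K),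
      IsConicRing l r x y ∧ e x = 0 ∧ e y = 0 ∧ (l ≠ 0 ∨ r ≠ 0) := by
  -- The Taylor expansion of the dehomogenized form at `a`: `l` is the gradient and `r` the
  -- quadratic part. The constant term vanishes because `a` lies on the conic.
  let l : Fin 2 → K := ![∑ i, (c (j + 1) i + c i (j + 1)) * a i,
    ∑ i, (c (j + 2) i + c i (j + 2)) * a i]
  let r : Fin 3 → K := ![c (j + 1) (j + 1), c (j + 1) (j + 2) + c (j + 2) (j + 1),
    c (j + 2) (j + 2)]
  have hj1 : j ≠ j + 1 := by fin_cases j <;> decide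
  have hj2 : j ≠ j + 2 := by fin_cases j <;> decide
  have h12 : j + 2 ≠ j + 1 := by fin_cases j <;> decide
  have hexp : ∀ (T : Type u) [CommRing T] [Algebra K T] (b : Fin 3 → T), b j = 1 →
      aeval b q = conicEval l r (b (j + 1) - algebraMap K T (a (j + 1)))
        (b (j + 2) - algebraMap K T (a (j + 2))) := by
    intro T _ _ b hb
    have ha' := congrArg (algebraMap K T) ha
    simp only [sum_fin_three_rotate _ j, haj, map_add, map_mul, map_one, map_zero] at ha'
    rw [hc]
    simp only [conicEval, l, r, map_mul, map_add, aeval_X, algHom_C,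
      sum_fin_three_rotate _ j, hb, haj, Matrix.cons_val_zero, Matrix.cons_val_one,
      Matrix.cons_val, map_one]
    linear_combination ha'
  have hρC : ∀ b : K, ρ (C b) = algebraMap K B b := fun b => by
    rw [← algebraMap_eq, AlgHom.commutes]
  have hρb : ρ = aeval fun i => ρ (X i) := by ext i; simp
  obtain ⟨e, he⟩ := hlift K (aeval a) (by simp [haj]) (by
    rw [hexp K a haj]
    simp [conicEval])
  have heX : ∀ i, e (ρ (X i)) = a i := fun i => by
    have := DFunLike.congr_fun he (X i)
    simpa using this
  refine ⟨l, r, ρ (X (j + 1)) - algebraMap K B (a (j + 1)),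
    ρ (X (j + 2)) - algebraMap K B (a (j + 2)), e, ⟨?_, ?_, ?_⟩, ?_, ?_, ?_⟩
  · set A := Algebra.adjoin K {ρ (X (j + 1)) - algebraMap K B (a (j + 1)),
      ρ (X (j + 2)) - algebraMap K B (a (j + 2))} with hA
    have h1 : ρ (X (j + 1)) ∈ A := by
      have := add_mem (Algebra.subset_adjoin (by simp) :
        ρ (X (j + 1)) - algebraMap K B (a (j + 1)) ∈ A) (A.algebraMap_mem (a (j + 1)))
      simpa using this
    have h2 : ρ (X (j + 2)) ∈ A := by
      have := add_mem (Algebra.subset_adjoin (by simp) :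
        ρ (X (j + 2)) - algebraMap K B (a (j + 2)) ∈ A) (A.algebraMap_mem (a (j + 2)))
      simpa using this
    have h3 : ∀ i, ρ (X i) ∈ A := by
      intro i
      have : i = j ∨ i = j + 1 ∨ i = j + 2 := by
        fin_cases i <;> fin_cases j <;> decide
      rcases this with rfl | rfl | rfl
      exacts [hρj ▸ one_mem A, h1, h2]
    rw [eq_top_iff]
    rintro b -
    obtain ⟨p, rfl⟩ := hρ b
    induction p using MvPolynomial.induction_on with
    | C b => rw [hρC]; exact A.algebraMap_mem b
    | add p p' hp hp' => rw [map_add]; exact add_mem hp hp'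
    | mul_X p i hp => rw [map_mul]; exact mul_mem hp (h3 i)
  · have := hexp B (fun i => ρ (X i)) hρj
    rwa [← hρb, hρq, eq_comm] at this
  · intro T _ _ x' y' h0
    let b : Fin 3 → T := fun i => if i = j + 1 then x' + algebraMap K T (a (j + 1)) else
      if i = j + 2 then y' + algebraMap K T (a (j + 2)) else 1
    have hbj : b j = 1 := by simp [b, hj1, hj2]
    have hb1 : b (j + 1) = x' + algebraMap K T (a (j + 1)) := by simp [b]
    have hb2 : b (j + 2) = y' + algebraMap K T (a (j + 2)) := by simp [b, h12]
    obtain ⟨h, hh⟩ := hlift T (aeval b) (by rw [aeval_X, hbj]) (by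
      rw [hexp T b hbj, hb1, hb2, add_sub_cancel_right, add_sub_cancel_right, h0])
    have hX : ∀ i, h (ρ (X i)) = b i := fun i => by
      have := DFunLike.congr_fun hh (X i)
      simpa using this
    refine ⟨h, ?_, ?_⟩
    · rw [map_sub, hX, hb1, AlgHom.commutes, add_sub_cancel_right]
    · rw [map_sub, hX, hb2, AlgHom.commutes, add_sub_cancel_right]
  · rw [map_sub, heX, AlgHom.commutes]
    exact sub_self _
  · rw [map_sub, heX, AlgHom.commutes]
    exact sub_self _
  · by_contra! hlr
    obtain ⟨hl, hr⟩ := hlr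
    have l0 : l 0 = 0 := congrFun hl 0
    have l1 : l 1 = 0 := congrFun hl 1
    have r0 : r 0 = 0 := congrFun hr 0
    have r1 : r 1 = 0 := congrFun hr 1
    have r2 : r 2 = 0 := congrFun hr 2
    simp only [l, r, Matrix.cons_val_zero, Matrix.cons_val_one, Matrix.cons_val,
      sum_fin_three_rotate _ j, haj] at l0 l1 r0 r1 r2 ha
    -- If `l` and `r` vanish, the mixed coefficients involving `xⱼ` are recovered from `l`, and that
    -- of `xⱼ ^ 2` from the equation at `a`; thus `q = 0`.
    have d1 : c j (j + 1) + c (j + 1) j = 0 := by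
      linear_combination l0 - 2 * a (j + 1) * r0 - a (j + 2) * r1
    have d2 : c j (j + 2) + c (j + 2) j = 0 := by
      linear_combination l1 - 2 * a (j + 2) * r2 - a (j + 1) * r1
    have d0 : c j j = 0 := by
      linear_combination ha - a (j + 1) * d1 - a (j + 2) * d2 - a (j + 1) ^ 2 * r0 -
        a (j + 1) * a (j + 2) * r1 - a (j + 2) ^ 2 * r2
    apply hq
    have hC : ∀ {b b' : K}, b + b' = 0 → (C b + C b' : MvPolynomial (Fin 3) K) = 0 :=
      fun h => by rw [← C_add, h, C_0]
    rw [hc]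
    simp only [sum_fin_three_rotate _ j, d0, r0, r2, C_0]
    linear_combination X j * X (j + 1) * hC d1 + X j * X (j + 2) * hC d2 +
      X (j + 1) * X (j + 2) * hC r1

end ConicChart

/-! ### The generic fibre and its function field -/

section Fibre

/-- Localizations are formally smooth. Composition with `κ` turns formal smoothness over a local
ring of the base into formal smoothness over `R`. -/
theorem exists_formallySmooth_specMap_eq_fromSpecStalk {R : CommRingCat.{u}} (y : Spec R) :
    ∃ κ : R ⟶ (Spec R).presheaf.stalk y,
      Spec.map κ = (Spec R).fromSpecStalk y ∧ κ.hom.FormallySmooth := by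
  refine ⟨StructureSheaf.toStalk R y, (AlgebraicGeometry.Spec.fromSpecStalk_eq' R y).symm, ?_⟩
  let y' : PrimeSpectrum R := y
  have h : Algebra.FormallySmooth R ((Spec.structureSheaf R).presheaf.stalk y') :=
    Algebra.FormallySmooth.of_isLocalization y'.asIdeal.primeCompl
  exact h

/-- The local rings of a smooth scheme over an affine scheme are formally smooth. -/
theorem formallySmooth_stalk {X : Scheme.{u}} {R : CommRingCat.{u}} (π : X ⟶ Spec R) [Smooth π]
    (x : X) (κ : R ⟶ X.presheaf.stalk x) (hκ : Spec.map κ = X.fromSpecStalk x ≫ π) :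
    κ.hom.FormallySmooth := by
  have h1 : (π.stalkMap x).hom.FormallySmooth := by
    rw [← Scheme.Hom.mem_smoothLocus, π.smoothLocus_eq_top]
    trivial
  obtain ⟨κ₀, hκ₀, h3⟩ := exists_formallySmooth_specMap_eq_fromSpecStalk (π x)
  have h2 : κ = κ₀ ≫ π.stalkMap x := by
    apply Spec.map_injective
    rw [Spec.map_comp, hκ, hκ₀, Scheme.SpecMap_stalkMap_fromSpecStalk]
  rw [h2, CommRingCat.hom_comp]
  exact h3.comp h1

open MvPolynomial in
/-- The local ring of an isotropic plane conic at a rational point. -/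
theorem exists_isConicRing_stalk {K : Type u} [Field K] {C : Scheme.{u}} (π : C ⟶ Spec (.of K))
    (hC : IsPlaneConic (Over.mk π))
    (hK : ∀ c : Fin 3 → Fin 3 → K, ∃ b : Fin 3 → K, b ≠ 0 ∧ ∑ i, ∑ j, c i j * b i * b j = 0) :
    ∃ (z : C) (B : Type u) (_ : CommRing B) (_ : Algebra K B) (l : Fin 2 → K) (r : Fin 3 → K)
      (x y : B) (e : B →ₐ[K] K) (g : B →+* C.presheaf.stalk z) (M : Submonoid B),
      IsConicRing l r x y ∧ e x = 0 ∧ e y = 0 ∧ (l ≠ 0 ∨ r ≠ 0) ∧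
      @IsLocalization B _ M (C.presheaf.stalk z) _ g.toAlgebra ∧ (∀ b ∈ M, e b ≠ 0) ∧
      Spec.map (CommRingCat.ofHom (g.comp (algebraMap K B))) = C.fromSpecStalk z ≫ π := by
  obtain ⟨q, hq, i, hq0, hi, hker⟩ := hC
  obtain ⟨c, hc⟩ := exists_eq_sum_of_isHomogeneous_two hq
  obtain ⟨a', ha'0, ha'⟩ := hK c
  obtain ⟨j, hj⟩ := Function.ne_iff.mp ha'0
  let a : Fin 3 → K := fun i => a' i / a' j
  have haj : a j = 1 := div_self hj
  have ha : ∑ i, ∑ j, c i j * a i * a j = 0 := by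
    have : ∑ i, ∑ j, c i j * a i * a j = (∑ i, ∑ j, c i j * a' i * a' j) * (a' j)⁻¹ ^ 2 := by
      rw [Finset.sum_mul]
      refine Finset.sum_congr rfl fun i _ => ?_
      rw [Finset.sum_mul]
      refine Finset.sum_congr rfl fun j _ => ?_
      simp only [a]
      ring
    rw [this, ha', zero_mul]
  let φ := (i.left.app (chart K 2 j).1).hom
  have hφ : Function.Surjective φ := i.left.app_surjective _ (chart K 2 j).2
  let U : C.Opens := i.left ⁻¹ᵁ (chart K 2 j).1
  have hU : IsAffineOpen U := (chart K 2 j).2.preimage i.left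
  let B : Type u := Γ(C, U)
  let ρ₀ : MvPolynomial (Fin 3) K →+* B := φ.comp (toSection K 2 j)
  let : Algebra K B := (ρ₀.comp MvPolynomial.C).toAlgebra
  let ρ : MvPolynomial (Fin 3) K →ₐ[K] B := { toRingHom := ρ₀, commutes' := fun _ => rfl }
  have hρX : ρ (X j) = 1 := (congrArg φ (toSection_X_self K 2 j)).trans (map_one φ)
  have hkerφ : RingHom.ker φ = Ideal.span {toSection K 2 j q} := by
    rw [toSection_of_isHomogeneous K 2 j hq, ← hker j, Scheme.Hom.ker_apply]
  have hρq : ρ q = 0 := by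
    have : toSection K 2 j q ∈ RingHom.ker φ := hkerφ ▸ Ideal.mem_span_singleton_self _
    exact this
  obtain ⟨l, r, x, y, e, hB, hx, hy, hlr⟩ := exists_isConicRing c hc hq0 j a haj ha ρ
    (hφ.comp (toSection_surjective K 2 j)) hρX hρq (by
      intro T _ _ h hhj hhq
      obtain ⟨h₁, hh₁⟩ := exists_lift_toSection K 2 j h.toRingHom hhj
      have hle : RingHom.ker φ ≤ RingHom.ker h₁ := by
        rw [hkerφ, Ideal.span_singleton_le_iff_mem]
        exact (DFunLike.congr_fun hh₁ q).trans hhq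
      let h₂ : B →+* T := RingHom.liftOfSurjective φ hφ ⟨h₁, hle⟩
      have h₂φ : ∀ s, h₂ (φ s) = h₁ s := fun s =>
        RingHom.liftOfRightInverse_comp_apply φ _ _ ⟨h₁, hle⟩ s
      have h₂ρ : ∀ p, h₂ (ρ p) = h p := fun p =>
        (h₂φ (toSection K 2 j p)).trans (DFunLike.congr_fun hh₁ p)
      refine ⟨{ toRingHom := h₂, commutes' := fun s => ?_ }, AlgHom.ext h₂ρ⟩
      refine (h₂ρ (MvPolynomial.C s)).trans ?_
      rw [← MvPolynomial.algebraMap_eq, AlgHom.commutes])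
  -- The rational point, as the kernel of evaluation `e`; functions outside this prime have nonzero
  -- value under `e`.
  let P : Spec Γ(C, U) := Spec.map (CommRingCat.ofHom e.toRingHom) (IsLocalRing.closedPoint K)
  let z : C := hU.fromSpec P
  have hz : z ∈ U := by
    have h : z ∈ Set.range hU.fromSpec := ⟨P, rfl⟩
    rwa [hU.range_fromSpec] at h
  have hP : hU.primeIdealOf ⟨z, hz⟩ = P :=
    hU.fromSpec.isOpenEmbedding.injective (hU.fromSpec_primeIdealOf ⟨z, hz⟩)
  refine ⟨z, B, inferInstance, inferInstance, l, r, x, y, e, (C.presheaf.germ U z hz).hom,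
    (hU.primeIdealOf ⟨z, hz⟩).asIdeal.primeCompl, hB, hx, hy, hlr,
    hU.isLocalization_stalk ⟨z, hz⟩, ?_, ?_⟩
  · intro b hb hbe
    apply hb
    rw [hP]
    change e b ∈ (IsLocalRing.closedPoint K).asIdeal
    rw [hbe]
    exact zero_mem _
  · have h1 : hU.fromSpec ≫ π = Spec.map (CommRingCat.ofHom (algebraMap K B)) := by
      have h2 : π = i.left ≫ (projectiveSpace K 2).hom := (Over.w i).symm
      have h3 := (chart K 2 j).2.SpecMap_appLE_fromSpec i.left hU le_rfl
      rw [h2, ← Category.assoc, ← h3, Category.assoc, fromSpec_chart_hom, ← Spec.map_comp,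
        ← Scheme.Hom.app_eq_appLE]
      rfl
    rw [← hU.fromSpecStalk_eq_fromSpecStalk hz, IsAffineOpen.fromSpecStalk, Category.assoc, h1,
      ← Spec.map_comp]
    rfl

/-- The function field of a smooth integral scheme over `k`, one of whose generic fibres is
an isotropic plane conic over `K`, is a simple transcendental extension of `K`. -/
theorem exists_transcendental_generator_of_isPlaneConic {k K : Type u} [Field k] [Field K]
    [Algebra k K] {X C : Scheme.{u}} [IsIntegral X] (πX : X ⟶ Spec (.of k)) [Smooth πX]
    (π : C ⟶ Spec (.of K)) (ι : C ⟶ X) [IsPreimmersion ι]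
    (hι : ι ≫ πX = π ≫ Spec.map (CommRingCat.ofHom (algebraMap k K)))
    (hC : IsPlaneConic (Over.mk π))
    (hK : ∀ c : Fin 3 → Fin 3 → K, ∃ b : Fin 3 → K, b ≠ 0 ∧ ∑ i, ∑ j, c i j * b i * b j = 0)
    [Algebra K (X.residueField (genericPoint X))]
    (α : Spec (X.residueField (genericPoint X)) ⟶ C)
    (hαι : α ≫ ι = X.fromSpecResidueField (genericPoint X))
    (hαπ : α ≫ π =
      Spec.map (CommRingCat.ofHom (algebraMap K (X.residueField (genericPoint X))))) :
    ∃ w : X.residueField (genericPoint X),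
      Transcendental K w ∧ IntermediateField.adjoin K {w} = ⊤ := by
  obtain ⟨z, B, _, _, l, r, x, y, e, g, M, hB, hx, hy, hlr, hloc, hM, hgπ⟩ :=
    exists_isConicRing_stalk π hC hK
  let F := X.residueField (genericPoint X)
  -- This map of local rings is an isomorphism. It is surjective because `ι` is a preimmersion, and
  -- injective because composing it with `θ` gives the inclusion of a local ring of `X` into its
  -- function field.
  let s := ι.stalkMap z
  have hs : Function.Surjective s := ι.stalkMap_surjective z
  have hspec : α (IsLocalRing.closedPoint F) ⤳ z := by
    rw [← ι.isEmbedding.isInducing.specializes_iff]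
    have h1 : ∀ t, ι (α t) = genericPoint X := fun t => by
      rw [← Scheme.Hom.comp_apply, hαι, Scheme.fromSpecResidueField_apply]
    exact (specializes_of_eq (h1 _)).trans (genericPoint_specializes _)
  let θ : C.presheaf.stalk z ⟶ F :=
    C.presheaf.stalkSpecializes hspec ≫ Scheme.stalkClosedPointTo α
  have hθ : Spec.map θ ≫ C.fromSpecStalk z = α := by
    rw [Spec.map_comp, Category.assoc, Scheme.SpecMap_stalkSpecializes_fromSpecStalk,
      Scheme.Spec_stalkClosedPointTo_fromSpecStalk]
  let can : X.presheaf.stalk (ι z) ⟶ F :=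
    X.presheaf.stalkSpecializes (genericPoint_specializes (ι z)) ≫ X.residue (genericPoint X)
  have hsθ : s ≫ θ = can := by
    apply Spec.map_injective
    rw [← cancel_mono (X.fromSpecStalk (ι z)), Spec.map_comp, Category.assoc,
      Scheme.SpecMap_stalkMap_fromSpecStalk, reassoc_of% hθ, hαι, Spec.map_comp,
      Category.assoc, Scheme.SpecMap_stalkSpecializes_fromSpecStalk]
    rfl
  have hres : Function.Bijective (X.residue (genericPoint X)) :=
    ⟨(X.residue (genericPoint X)).hom.injective (R := X.functionField),
      X.residue_surjective _⟩
  have hcan : Function.Injective can :=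
    hres.1.comp (IsFractionRing.injective (X.presheaf.stalk (ι z)) X.functionField)
  have hcan' : ∀ w : F, ∃ a b, w = can a / can b := by
    intro w
    obtain ⟨w, rfl⟩ := hres.2 w
    obtain ⟨a, b, -, rfl⟩ := IsFractionRing.div_surjective (A := X.presheaf.stalk (ι z))
      (K := X.functionField) w
    exact ⟨a, b, map_div₀ (X.residue (genericPoint X)).hom
      (algebraMap (X.presheaf.stalk (ι z)) X.functionField a)
      (algebraMap (X.presheaf.stalk (ι z)) X.functionField b)⟩
  have hsθ' : ∀ a, θ (s a) = can a := fun a => by rw [← hsθ]; rfl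
  have hs' : Function.Injective s := fun a b hab => hcan (by rw [← hsθ', hab, hsθ'])
  have hθinj : Function.Injective θ := by
    intro a b hab
    obtain ⟨a, rfl⟩ := hs a
    obtain ⟨b, rfl⟩ := hs b
    rw [hsθ', hsθ'] at hab
    rw [hcan hab]
  let S : Type u := C.presheaf.stalk z
  let : Algebra B S := g.toAlgebra
  let : Algebra K S := (g.comp (algebraMap K B)).toAlgebra
  have : IsScalarTower K B S := IsScalarTower.of_algebraMap_eq fun _ => rfl
  let : Algebra k S := ((algebraMap K S).comp (algebraMap k K)).toAlgebra
  have : IsScalarTower k K S := IsScalarTower.of_algebraMap_eq fun _ => rfl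
  let : Algebra S F := θ.hom.toAlgebra
  have hKS : CommRingCat.ofHom (algebraMap K S) ≫ θ = CommRingCat.ofHom (algebraMap K F) := by
    apply Spec.map_injective
    rw [← hαπ, ← hθ, Spec.map_comp, Category.assoc, ← hgπ]
  have : IsScalarTower K S F := IsScalarTower.of_algebraMap_eq fun a =>
    (DFunLike.congr_fun (congrArg CommRingCat.Hom.hom hKS) a).symm
  have : IsDomain S := hθinj.isDomain θ.hom
  have : FaithfulSMul S F := (faithfulSMul_iff_algebraMap_injective S F).mpr hθinj
  have : IsFractionRing S F := IsFractionRing.of_field S F fun w => by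
    obtain ⟨a, b, rfl⟩ := hcan' w
    exact ⟨s a, s b, by rw [← hsθ', ← hsθ']; rfl⟩
  -- Transported along the isomorphism `s` from the local ring of the smooth scheme `X`.
  have : Algebra.FormallySmooth k S := by
    let κ := Spec.preimage (X.fromSpecStalk (ι z) ≫ πX)
    have h1 := formallySmooth_stalk πX (ι z) κ (Spec.map_preimage _)
    have h2 : CommRingCat.ofHom (algebraMap k S) = κ ≫ s := by
      apply Spec.map_injective
      rw [Spec.map_comp, Spec.map_preimage, Scheme.SpecMap_stalkMap_fromSpecStalk_assoc, hι,
        ← reassoc_of% hgπ, ← Spec.map_comp]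
      rfl
    rw [← RingHom.formallySmooth_algebraMap]
    have h3 : algebraMap k S = s.hom.comp κ.hom := congrArg CommRingCat.Hom.hom h2
    rw [h3]
    exact h1.comp (RingHom.FormallySmooth.of_bijective ⟨hs', hs⟩)
  exact hB.exists_transcendental_generator (S := S) (F := F) e hx hy hM
    (hB.linear_ne_zero (k := k) (S := S) e hx hy hM hlr)

end Fibre

/-! ### Automorphisms and their action on function fields -/

section Automorphisms

/-- Tsen's theorem for the function field of the projective line. -/
theorem exists_isotropic_residueField {k : Type u} [Field k] [IsAlgClosed k]
    {η : (projectiveSpace k 1).left} (hη : ∀ y, η ⤳ y)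
    (c : Fin 3 → Fin 3 → (projectiveSpace k 1).left.residueField η) :
    ∃ b : Fin 3 → (projectiveSpace k 1).left.residueField η,
      b ≠ 0 ∧ ∑ i, ∑ j, c i j * b i * b j = 0 := by
  let c₀ : CommRingCat.of k ⟶ (projectiveSpace k 1).left.residueField η :=
    Spec.preimage ((projectiveSpace k 1).left.fromSpecResidueField η ≫ (projectiveSpace k 1).hom)
  let := c₀.hom.toAlgebra
  obtain ⟨t, ht, hK⟩ := exists_transcendental_residueField hη (Spec.map_preimage _)
  exact exists_isotropic ht hK c

/-- Keeping `y` separate from `h x` makes an automorphism fixing a point act on a single residue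
field, without transport along the equality. -/
theorem exists_residueField_map {X Y : Scheme.{u}} (h : X ⟶ Y) {x : X} {y : Y} (e : h x = y) :
    ∃ φ : Y.residueField y ⟶ X.residueField x,
      Spec.map φ ≫ Y.fromSpecResidueField y = X.fromSpecResidueField x ≫ h := by
  subst e
  exact ⟨h.residueFieldMap x, Scheme.Hom.SpecMap_residueFieldMap_fromSpecResidueField h x⟩

/-- An automorphism fixes the generic point. -/
theorem aut_apply_of_forall_specializes {k : Type u} [Field k] {B : Over (Spec (.of k))}
    (τ : Aut B) {η : B.left} (hη : ∀ y, η ⤳ y) : τ.hom.left η = η := by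
  have h1 : τ.hom.left (τ.inv.left η) = η := by
    rw [← Scheme.Hom.comp_apply, ← Over.comp_left, τ.inv_hom_id]
    rfl
  have h2 : τ.hom.left η ⤳ η :=
    ((hη (τ.inv.left η)).map τ.hom.left.continuous).trans (specializes_of_eq h1)
  exact (h2.antisymm (hη _)).eq

theorem exists_specMap_pow_fromSpecResidueField {k : Type u} [Field k] {X : Over (Spec (.of k))}
    (σ : Aut X) (x : X.left) (φ : X.left.residueField x →+* X.left.residueField x)
    (hφ : Spec.map (CommRingCat.ofHom φ) ≫ X.left.fromSpecResidueField x =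
      X.left.fromSpecResidueField x ≫ σ.hom.left) (n : ℕ) :
    ∃ g : X ⟶ X, (σ ^ n).hom = g ∧
      Spec.map (CommRingCat.ofHom (φ ^ n)) ≫ X.left.fromSpecResidueField x =
        X.left.fromSpecResidueField x ≫ g.left := by
  induction n with
  | zero =>
    refine ⟨𝟙 X, rfl, ?_⟩
    change Spec.map (𝟙 (X.left.residueField x)) ≫ _ = _
    rw [Spec.map_id, Category.id_comp, Over.id_left, Category.comp_id]
  | succ n ih =>
    obtain ⟨g, hg, ih⟩ := ih
    have h1 : CommRingCat.ofHom (φ ^ (n + 1)) = CommRingCat.ofHom φ ≫ CommRingCat.ofHom (φ ^ n) := by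
      rw [pow_succ]
      rfl
    refine ⟨g ≫ σ.hom, ?_, ?_⟩
    · rw [← hg, pow_succ']
      rfl
    · rw [h1, Spec.map_comp, Category.assoc, hφ, reassoc_of% ih, Over.comp_left]

/-- An automorphism of an integral separated scheme is determined by its effect on the function
field. -/
theorem pow_eq_one_iff_residueField {k : Type u} [Field k] {X : Over (Spec (.of k))}
    [IsIntegral X.left] [IsSeparated X.hom] (σ : Aut X)
    (φ : X.left.residueField (genericPoint X.left) →+*
      X.left.residueField (genericPoint X.left))
    (hφ : Spec.map (CommRingCat.ofHom φ) ≫ X.left.fromSpecResidueField _ =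
      X.left.fromSpecResidueField _ ≫ σ.hom.left) (n : ℕ) : σ ^ n = 1 ↔ φ ^ n = 1 := by
  obtain ⟨g, hg, hn⟩ := exists_specMap_pow_fromSpecResidueField σ _ φ hφ n
  constructor
  · intro h
    have h2 : g = 𝟙 X := by rw [← hg, h]; rfl
    have h3 : Spec.map (CommRingCat.ofHom (φ ^ n)) = Spec.map (𝟙 _) := by
      rw [← cancel_mono (X.left.fromSpecResidueField _), hn, h2, Spec.map_id, Category.id_comp,
        Over.id_left, Category.comp_id]
    exact congrArg CommRingCat.Hom.hom (Spec.map_injective h3)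
  · intro h
    rw [h] at hn
    change Spec.map (𝟙 (X.left.residueField _)) ≫ _ = _ at hn
    rw [Spec.map_id, Category.id_comp] at hn
    -- The generic point is dense and the scheme is reduced and separated, so endomorphisms over `k`
    -- agreeing at the generic point are equal.
    have hdom : IsDominant (X.left.fromSpecResidueField (genericPoint X.left)) := by
      constructor
      rw [DenseRange, Scheme.range_fromSpecResidueField, dense_iff_closure_eq]
      exact genericPoint_closure _
    have h2 : g.left = 𝟙 X.left := by
      refine ext_of_isDominant_of_isSeparated X.hom ?_
        (X.left.fromSpecResidueField (genericPoint X.left)) ?_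
      · rw [Over.w, Category.id_comp]
      · rw [← hn, Category.comp_id]
    exact Iso.ext (hg.trans (Over.OverMorphism.ext h2))

theorem isIso_left {k : Type u} [Field k] {X Y : Over (Spec (.of k))} (e : X ≅ Y) :
    IsIso e.hom.left :=
  ((Over.forget _).mapIso e).isIso_hom

end Automorphisms

end ConicBundle

/-! ### The bound on the order -/

theorem corollary3 {k : Type u} [Field k] [IsAlgClosed k] (p : ℕ) [Fact p.Prime] [CharP k p]
    (X : Over (Spec (.of k))) (f : X ⟶ ConicBundle.projectiveSpace k 1)
    (hf : ConicBundle.IsConicBundle f) (σ : Aut X)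
    (hσ : ConicBundle.PreservesFibration f σ) (s : ℕ) (hs : orderOf σ = p ^ s) :
    s ≤ 2 := by
  obtain ⟨τ, hτ⟩ := hσ
  have := hf.surface.isIntegral
  have := hf.surface.isProper
  have := hf.surface.smooth
  have : Smooth X.hom := SmoothOfRelativeDimension.smooth 2 X.hom
  let P := ConicBundle.projectiveSpace k 1
  let ξ := genericPoint X.left
  let η : P.left := f.left ξ
  -- Dominance of `f`: by Tsen's theorem the fibre over the generic point `η₀` of the base contains
  -- a point. The generic point of `X` specializes to it, so its image specializes to `η₀`.
  have hη : ∀ y, η ⤳ y := by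
    obtain ⟨η₀, -, hη₀⟩ := ConicBundle.exists_specializes_projectiveSpace k 1 0
    obtain ⟨z, -⟩ := ConicBundle.exists_isConicRing_stalk (f.left.fiberToSpecResidueField η₀)
      (hf.isPlaneConic_fibre η₀) (ConicBundle.exists_isotropic_residueField hη₀)
    have h1 : f.left (f.left.fiberι η₀ z) = η₀ := by
      have : f.left.fiberι η₀ z ∈ Set.range (f.left.fiberι η₀) := ⟨z, rfl⟩
      rwa [Scheme.Hom.range_fiberι] at this
    intro y
    have h2 : η ⤳ f.left (f.left.fiberι η₀ z) :=
      (genericPoint_specializes _).map f.left.continuous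
    exact h2.trans ((specializes_of_eq h1).trans (hη₀ y))
  let K := P.left.residueField η
  let F := X.left.residueField ξ
  let c₀ : CommRingCat.of k ⟶ K := Spec.preimage (P.left.fromSpecResidueField η ≫ P.hom)
  have hc₀ : Spec.map c₀ = P.left.fromSpecResidueField η ≫ P.hom := Spec.map_preimage _
  let : Algebra k K := c₀.hom.toAlgebra
  let : Algebra K F := (f.left.residueFieldMap ξ).hom.toAlgebra
  obtain ⟨t, ht, hK⟩ := ConicBundle.exists_transcendental_residueField hη hc₀
  obtain ⟨w, hw, hF⟩ := ConicBundle.exists_transcendental_generator_of_isPlaneConic (K := K) X.hom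
    (f.left.fiberToSpecResidueField η) (f.left.fiberι η)
    (by
      have h1 : X.hom = f.left ≫ P.hom := (Over.w f).symm
      rw [h1, reassoc_of% f.left.fiber_fac η, ← hc₀]
      rfl)
    (hf.isPlaneConic_fibre η) (ConicBundle.exists_isotropic_residueField hη)
    (f.left.asFiberHom ξ) (f.left.asFiberHom_fiberι ξ)
    (f.left.asFiberHom_fiberToSpecResidueField ξ)
  have : IsIso σ.hom.left := ConicBundle.isIso_left σ
  obtain ⟨φ, hφ⟩ := ConicBundle.exists_residueField_map σ.hom.left
    (genericPoint_eq_of_isOpenImmersion σ.hom.left)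
  obtain ⟨ψ, hψ⟩ := ConicBundle.exists_residueField_map τ.hom.left
    (ConicBundle.aut_apply_of_forall_specializes τ hη)
  have hψk : c₀ ≫ ψ = c₀ := by
    apply Spec.map_injective
    rw [Spec.map_comp, hc₀, reassoc_of% hψ, Over.w]
  have hcomm : ∀ a, ψ.hom (algebraMap k K a) = algebraMap k K a := fun a =>
    DFunLike.congr_fun (congrArg CommRingCat.Hom.hom hψk) a
  let ψ' : K →ₐ[k] K := { toRingHom := ψ.hom, commutes' := hcomm }
  have hφψ : f.left.residueFieldMap ξ ≫ φ = ψ ≫ f.left.residueFieldMap ξ := by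
    apply Spec.map_injective
    rw [← cancel_mono (P.left.fromSpecResidueField η), Spec.map_comp, Spec.map_comp,
      Category.assoc, Category.assoc, hψ,
      Scheme.Hom.SpecMap_residueFieldMap_fromSpecResidueField, reassoc_of% hφ,
      Scheme.Hom.SpecMap_residueFieldMap_fromSpecResidueField_assoc, ← Over.comp_left, hτ,
      Over.comp_left]
  have hiff := ConicBundle.pow_eq_one_iff_residueField σ φ.hom hφ
  have h1 : φ.hom ^ p ^ s = 1 := (hiff _).mp (hs ▸ pow_orderOf_eq_one σ)
  have h2 := ConicBundle.ringHom_pow_char_sq_eq_one p ht hK hw hF φ.hom ψ'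
    (fun a => DFunLike.congr_fun (congrArg CommRingCat.Hom.hom hφψ) a) s h1
  have h3 := orderOf_dvd_of_pow_eq_one ((hiff _).mpr h2)
  rw [hs] at h3
  exact (Nat.pow_dvd_pow_iff_le_right (Fact.out : p.Prime).one_lt).mp h3
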